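/- **Setting.** Let $G$ be a finite simple bipartite graph with vertex set $\mathbf V=\mathbf S\sqcup\mathbf R$ (sources and ranges), every connected component of which is a complete bipartite graph; let $\mathbf P$ be the set of components, $[v]\in\mathbf P$ the component of a vertex $v$, and write an edge as $e=(\mathbf s(e),\mathbf r(e))\in\mathbf S\times\mathbf R$. For each $p\in\mathbf P$ let $\mathcal H^\circ_p$ be a finite-dimensional complex Hilbert space, and let $\mathcal K$ be an infinite-dimensional separable complex Hilbert space. For Hilbert spaces $\mathcal H_p$ ($p\in\mathbf P$) put $\mathcal H_{\mathbf S}=\bigoplus_{s\in\mathbf S}\mathcal H_{[s]}$, $\mathcal H_{\mathbf R}=\bigoplus_{r\in\mathbf R}\mathcal H_{[r]}$ (Hilbert space direct sums), with canonical embeddings $\iota_s,\iota_r$. Given algebras $\boldsymbol\Delta_p\subset\mathcal L(\mathcal H_p)$, the uncertainty set is $$\boldsymbol\Delta=\Big\{\sum_{e}\iota_{\mathbf s(e)}Z_e\,\iota_{\mathbf r(e)}^*:\ Z_e\in\boldsymbol\Delta_{[\mathbf s(e)]}\Big\}\subset\mathcal L(\mathcal H_{\mathbf R},\mathcal H_{\mathbf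 S}).$$ Its intertwining space is $\boldsymbol\Delta'=\{(X,Y)\in\mathcal L(\mathcal H_{\mathbf R})\times\mathcal L(\mathcal H_{\mathbf S}):\ \Delta X=Y\Delta\ \text{for all }\Delta\in\boldsymbol\Delta\}$. For $M\in\mathcal L(\mathcal H_{\mathbf S},\mathcal H_{\mathbf R})$ define $$\mu_{\boldsymbol\Delta}(M)=\frac1{\inf\{\|\Delta\|:\ \Delta\in\boldsymbol\Delta,\ 1\in\sigma(M\Delta)\}},\qquad \widehat\mu_{\boldsymbol\Delta}(M)=\inf\{\|XMY^{-1}\|:\ (X,Y)\in\boldsymbol\Delta',\ X,Y\text{ invertible}\},$$ where $\inf\emptyset=\infty$ and $1/\infty=0$. Let $\boldsymbol\Delta_{\mathbf G^\circ}$ be the uncertainty set for $\mathcal H_p=\mathcal H^\circ_p$, $\boldsymbol\Delta_p=\mathbb C\,I_{\mathcal H_p^\circ}$, and let $\boldsymbol\Delta_{\overline{\mathbf G}}$ be the one for $\mathcal H_p=\mathcal K\otimes\mathcal H^\circ_p$, $\boldsymbol\Delta_p=\mathcal L(\mathcal K)\otimes I_{\mathcal H^\circ_p}$. **Theorem.**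 For every linear operator $M^\circ:\mathcal H^\circ_{\mathbf S}\to\mathcal H^\circ_{\mathbf R}$, $$\widetilde\mu_{\boldsymbol\Delta_{\mathbf G^\circ}}(M^\circ):=\mu_{\boldsymbol\Delta_{\overline{\mathbf G}}}(I_{\mathcal K}\otimes M^\circ)=\widehat\mu_{\boldsymbol\Delta_{\mathbf G^\circ}}(M^\circ).$$ In particular $\widetilde\mu_{\boldsymbol\Delta_{\mathbf G^\circ}}(M^\circ)<1$ if and only if $\widehat\mu_{\boldsymbol\Delta_{\mathbf G^\circ}}(M^\circ)<1$, and testing this reduces to a finite-dimensional LMI: $\widetilde\mu_{\boldsymbol\Delta_{\mathbf G^\circ}}(M^\circ)<1$ holds if and only if there is $(X,Y)\in\boldsymbol\Delta_{\mathbf G^\circ}'$ with $X\succ0$, $Y\succ0$ and $M^{\circ*}XM^\circ-Y\prec0$; equivalently, if and only if there are $\Gamma_p\succ0$ on $\mathcal H^\circ_p$ ($p\in\mathbf P$) with $$M^{\circ*}\Big(\bigoplus_{r\in\mathbf R}\Gamma_{[r]}\Big)M^\circ-\bigoplus_{s\in\mathbf S}\Gamma_{[s]}\prec0 .$$ -/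

import Mathlib

open scoped TensorProduct ENNReal

noncomputable section

/-- A bipartite graph with a fixed decomposition of its vertices into sources `S` and ranges `R`,
each of whose connected components is a complete bipartite graph. -/
structure AdmissibleGraph (V : Type*) where
  graph : SimpleGraph V
  S : Set V
  R : Set V
  bipartite : graph.IsBipartiteWith S R
  cover : S ∪ R = Set.univ
  complete : ∀ s ∈ S, ∀ r ∈ R, graph.Reachable s r → graph.Adj s r

namespace AdmissibleGraph

variable {V : Type*}

/-- The set of connected components of the graph. -/
abbrev Comp (G : AdmissibleGraph V) : Type _ := G.graph.ConnectedComponent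

/-- The source vertices lying in the component `p`. -/
def Src (G : AdmissibleGraph V) (p : G.Comp) : Type _ :=
  {v : V // v ∈ G.S ∧ G.graph.connectedComponentMk v = p}

/-- The range vertices lying in the component `p`. -/
def Rng (G : AdmissibleGraph V) (p : G.Comp) : Type _ :=
  {v : V // v ∈ G.R ∧ G.graph.connectedComponentMk v = p}

/-- The edges of the component `p`, each given by its source vertex and its range vertex. -/
def Edge (G : AdmissibleGraph V) (p : G.Comp) : Type _ :=
  {e : G.Src p × G.Rng p // G.graph.Adj e.1.1 e.2.1}

/-- The source vertex of an edge. -/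
def Edge.src {G : AdmissibleGraph V} {p : G.Comp} (e : G.Edge p) : G.Src p := e.1.1

/-- The range vertex of an edge. -/
def Edge.rng {G : AdmissibleGraph V} {p : G.Comp} (e : G.Edge p) : G.Rng p := e.1.2

instance [Finite V] (G : AdmissibleGraph V) : Fintype G.Comp := Fintype.ofFinite _

instance [Finite V] (G : AdmissibleGraph V) (p : G.Comp) : Fintype (G.Src p) :=
  haveI : Finite (G.Src p) := Subtype.finite
  Fintype.ofFinite _

instance [Finite V] (G : AdmissibleGraph V) (p : G.Comp) : Fintype (G.Rng p) :=
  haveI : Finite (G.Rng p) := Subtype.finite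
  Fintype.ofFinite _

instance [Finite V] (G : AdmissibleGraph V) (p : G.Comp) : Fintype (G.Edge p) :=
  haveI : Finite (G.Edge p) := Subtype.finite
  Fintype.ofFinite _

variable [Finite V] (G : AdmissibleGraph V)

section Spaces

variable (H : G.Comp → Type*) [∀ p, NormedAddCommGroup (H p)] [∀ p, InnerProductSpace ℂ (H p)]

/-- The Hilbert space direct sum, over all source vertices `s`, of the space `H [s]` attached to
the component of `s`. -/
abbrev SrcSpace : Type _ := PiLp 2 (fun i : (p : G.Comp) × G.Src p => H i.1)

/-- The Hilbert space direct sum, over all range vertices `r`, of the space `H [r]` attached to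
the component of `r`. -/
abbrev RngSpace : Type _ := PiLp 2 (fun i : (p : G.Comp) × G.Rng p => H i.1)

/-- The embedding of `H p` as the summand belonging to the source vertex `s` of `p`. -/
def srcIncl {p : G.Comp} (s : G.Src p) : H p →L[ℂ] G.SrcSpace H :=
  open Classical in
  (PiLp.continuousLinearEquiv 2 ℂ
      (fun i : (p : G.Comp) × G.Src p => H i.1)).symm.toContinuousLinearMap ∘L
    ContinuousLinearMap.single ℂ (fun i : (p : G.Comp) × G.Src p => H i.1) ⟨p, s⟩

/-- The embedding of `H p` as the summand belonging to the range vertex `r` of `p`. -/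
def rngIncl {p : G.Comp} (r : G.Rng p) : H p →L[ℂ] G.RngSpace H :=
  open Classical in
  (PiLp.continuousLinearEquiv 2 ℂ
      (fun i : (p : G.Comp) × G.Rng p => H i.1)).symm.toContinuousLinearMap ∘L
    ContinuousLinearMap.single ℂ (fun i : (p : G.Comp) × G.Rng p => H i.1) ⟨p, r⟩

/-- The coordinate projection onto the summand of `s`; it is the adjoint of `srcIncl`. -/
def srcProj {p : G.Comp} (s : G.Src p) : G.SrcSpace H →L[ℂ] H p :=
  PiLp.proj 2 (fun i : (p : G.Comp) × G.Src p => H i.1) ⟨p, s⟩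

/-- The coordinate projection onto the summand of `r`; it is the adjoint of `rngIncl`. -/
def rngProj {p : G.Comp} (r : G.Rng p) : G.RngSpace H →L[ℂ] H p :=
  PiLp.proj 2 (fun i : (p : G.Comp) × G.Rng p => H i.1) ⟨p, r⟩

variable {H}

/-- The pencil `L(Z) = ∑ₑ ι_{s(e)} Zₑ ι_{r(e)}^*`, where the edge `e` of the component `p` carries
an operator `Zₑ` on `H p`. -/
def pencil (Z : ∀ p, G.Edge p → (H p →L[ℂ] H p)) : G.RngSpace H →L[ℂ] G.SrcSpace H :=
  ∑ p, ∑ e : G.Edge p, G.srcIncl H e.src ∘L Z p e ∘L G.rngProj H e.rng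

/-- The uncertainty set determined by the operator algebras `A p ⊆ L(H p)`: all `L(Z)` with
`Zₑ ∈ A p` for every edge `e` of `p`. (The definition uses only the underlying sets of the
algebras.) -/
def uncertainty (A : ∀ p, Set (H p →L[ℂ] H p)) : Set (G.RngSpace H →L[ℂ] G.SrcSpace H) :=
  {D | ∃ Z : ∀ p, G.Edge p → (H p →L[ℂ] H p), (∀ p e, Z p e ∈ A p) ∧ D = G.pencil Z}

/-- The operator `⨁_s Γ_{[s]}` on the source space. -/
def srcDiag (Γ : ∀ p, H p →L[ℂ] H p) : G.SrcSpace H →L[ℂ] G.SrcSpace H :=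
  ∑ p, ∑ s : G.Src p, G.srcIncl H s ∘L Γ p ∘L G.srcProj H s

/-- The operator `⨁_r Γ_{[r]}` on the range space. -/
def rngDiag (Γ : ∀ p, H p →L[ℂ] H p) : G.RngSpace H →L[ℂ] G.RngSpace H :=
  ∑ p, ∑ r : G.Rng p, G.rngIncl H r ∘L Γ p ∘L G.rngProj H r

end Spaces

section Structures

variable (H : G.Comp → Type*) [∀ p, NormedAddCommGroup (H p)] [∀ p, InnerProductSpace ℂ (H p)]
variable (K : Type*) [NormedAddCommGroup K] [InnerProductSpace ℂ K]

/-- The classical uncertainty set: the algebra on `H p` is `ℂ · I`. -/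
def classicalUncertainty : Set (G.RngSpace H →L[ℂ] G.SrcSpace H) :=
  G.uncertainty fun p => Set.range fun c : ℂ => c • ContinuousLinearMap.id ℂ (H p)

/-- The enhanced uncertainty set: the multiplicity space of `p` is `K ⊗ H p` and the algebra on it
is `L(K) ⊗ I`. For finite-dimensional `H p` and a Hilbert space `K`, the algebraic tensor product
with its inner product norm is already the Hilbert space tensor product. -/
def enhancedUncertainty :
    Set (G.RngSpace (fun p => K ⊗[ℂ] H p) →L[ℂ] G.SrcSpace (fun p => K ⊗[ℂ] H p)) :=
  G.uncertainty fun p => Set.range fun W : K →L[ℂ] K =>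
    TensorProduct.mapL W (ContinuousLinearMap.id ℂ (H p))

variable {H}

/-- The operator `I_K ⊗ M`, with `K ⊗ ⨁ₛ H [s]` identified with `⨁ₛ K ⊗ H [s]`, and likewise on
the range side: its `(r, s)` block is `I_K ⊗ M_{r,s}`, where `M_{r,s} = ι_r^* M ι_s`. -/
def idTensor (M : G.SrcSpace H →L[ℂ] G.RngSpace H) :
    G.SrcSpace (fun p => K ⊗[ℂ] H p) →L[ℂ] G.RngSpace (fun p => K ⊗[ℂ] H p) :=
  ∑ p, ∑ r : G.Rng p, ∑ q, ∑ s : G.Src q,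
    G.rngIncl (fun p => K ⊗[ℂ] H p) r ∘L
      TensorProduct.mapL (ContinuousLinearMap.id ℂ K) (G.rngProj H r ∘L M ∘L G.srcIncl H s) ∘L
        G.srcProj (fun p => K ⊗[ℂ] H p) s

end Structures

end AdmissibleGraph

section SingularValues

variable {E F : Type*} [NormedAddCommGroup E] [NormedSpace ℂ E]
  [NormedAddCommGroup F] [NormedSpace ℂ F]

/-- The structured singular value of `M` with respect to a set `𝓓` of operators: the reciprocal
(in `[0, ∞]`) of the infimum of `‖D‖` over those `D ∈ 𝓓` with `1 ∈ σ(M D)`. If there is no such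
`D`, the infimum is `∞` and the value is `0`. -/
def structuredSingularValue (𝓓 : Set (E →L[ℂ] F)) (M : F →L[ℂ] E) : ℝ≥0∞ :=
  (⨅ D ∈ {D : E →L[ℂ] F | D ∈ 𝓓 ∧ (1 : ℂ) ∈ spectrum ℂ (M ∘L D)}, ‖D‖ₑ)⁻¹

/-- The intertwining space of `𝓓`: the pairs `(X, Y)` with `D X = Y D` for all `D ∈ 𝓓`. -/
def intertwiners (𝓓 : Set (E →L[ℂ] F)) : Set ((E →L[ℂ] E) × (F →L[ℂ] F)) :=
  {XY | ∀ D ∈ 𝓓, D ∘L XY.1 = XY.2 ∘L D}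

/-- The diagonal scaling bound: the infimum of `‖X M Y⁻¹‖` over all pairs `(X, Y)` of invertible
operators in the intertwining space of `𝓓`. -/
def scalingBound (𝓓 : Set (E →L[ℂ] F)) (M : F →L[ℂ] E) : ℝ≥0∞ :=
  ⨅ (X : (E →L[ℂ] E)ˣ) (Y : (F →L[ℂ] F)ˣ)
    (_ : ((X : E →L[ℂ] E), (Y : F →L[ℂ] F)) ∈ intertwiners 𝓓),
    ‖(X : E →L[ℂ] E) ∘L M ∘L ((Y⁻¹ : (F →L[ℂ] F)ˣ) : F →L[ℂ] F)‖ₑ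

end SingularValues

end

/-!
The inequality `μ(I ⊗ M) ≤ μ̂(M)` is a similarity argument. If `(X, Y)` intertwines the classical
uncertainty set, then `(I ⊗ X, I ⊗ Y)` intertwines the enhanced one, so `(I ⊗ M) D` is similar to
`(I ⊗ X M Y⁻¹) D`, whose spectral radius is at most `‖X M Y⁻¹‖ ‖D‖`
(`structuredSingularValue_le_scalingBound`). Here `K ⊗ ⨁ᵢ Eᵢ` is identified with `⨁ᵢ K ⊗ Eᵢ` by the
unitary `tensorPiLp`, and `I ⊗ M` becomes `ampliation K M`.

The converse is a duality argument (`exists_lmi_or_exists_family`). If the matrix inequality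
`M* (⨁ᵣ Γ_[r]) M < ⨁ₛ Γ_[s]` has no strictly positive solution `Γ`, then Hahn–Banach separation,
applied to the compact convex set of density operators on the source space, provides a density
operator `T = ∑ᵢ |gᵢ⟩⟨gᵢ|` with `∑ₛ T_ss ≤ ∑ᵣ (M T M*)_rr` on the space of each component. As `K` is
infinite-dimensional, it has an orthonormal family `eᵢ` of the required size, and `T` is purified
to the vector `x = ∑ᵢ eᵢ ⊗ gᵢ`. With `y = (I ⊗ M) x`, the domination is exactly what Douglas' lemma
needs to produce, on each component, a contraction between multiples of `K` whose ampliation takes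
`y` to `x`. Since components are complete bipartite, these contractions form a contraction `D` in
the enhanced uncertainty set, and `(I ⊗ M) D y = y` (`exists_enhanced_of_family`). Applied to
`t⁻¹ M`, this shows that `μ(I ⊗ M) < t` makes the matrix inequality for `t⁻¹ M` solvable.

A solution `(X, Y)` of the matrix inequality in the intertwining space gives `μ̂(M) < 1` by scaling
with the square roots of `X` and `Y`, which intertwine as well (`scalingBound_lt_one`).
By homogeneity `μ̂(M) ≤ t`, hence `μ̂(M) ≤ μ(I ⊗ M)`, and the two matrix inequality criteria follow.
-/

/-! ### Ampliations -/

section Ampliation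

variable {K : Type*} [NormedAddCommGroup K] [InnerProductSpace ℂ K]
variable {ι κ τ : Type*} [Fintype ι] [Fintype κ] [Fintype τ]
  {E : ι → Type*} [∀ i, NormedAddCommGroup (E i)] [∀ i, InnerProductSpace ℂ (E i)]
  {F : κ → Type*} [∀ i, NormedAddCommGroup (F i)] [∀ i, InnerProductSpace ℂ (F i)]
  {T : τ → Type*} [∀ i, NormedAddCommGroup (T i)] [∀ i, InnerProductSpace ℂ (T i)]

/-- The linear map `K ⊗ ⨁ᵢ Eᵢ → ⨁ᵢ K ⊗ Eᵢ`. -/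
noncomputable def tensorPiLpLinear (K : Type*) [NormedAddCommGroup K] [InnerProductSpace ℂ K]
    (E : ι → Type*) [∀ i, NormedAddCommGroup (E i)] [∀ i, InnerProductSpace ℂ (E i)] :
    K ⊗[ℂ] PiLp 2 E →ₗ[ℂ] PiLp 2 (fun i => K ⊗[ℂ] E i) :=
  (WithLp.linearEquiv 2 ℂ (∀ i, K ⊗[ℂ] E i)).symm.toLinearMap ∘ₗ
    LinearMap.pi fun i => ((PiLp.proj 2 E i : PiLp 2 E →L[ℂ] E i).lTensor K).toLinearMap

lemma tensorPiLpLinear_tmul (k : K) (x : PiLp 2 E) (i : ι) :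
    tensorPiLpLinear K E (k ⊗ₜ x) i = k ⊗ₜ x i := rfl

lemma inner_tensorPiLpLinear (z w : K ⊗[ℂ] PiLp 2 E) :
    inner ℂ (tensorPiLpLinear K E z) (tensorPiLpLinear K E w) = inner ℂ z w := by
  induction z with
  | zero => simp
  | add z₁ z₂ h₁ h₂ => rw [map_add, inner_add_left, inner_add_left, h₁, h₂]
  | tmul k x =>
    induction w with
    | zero => simp
    | add w₁ w₂ h₁ h₂ => rw [map_add, inner_add_right, inner_add_right, h₁, h₂]
    | tmul l y =>
      simp only [PiLp.inner_apply, tensorPiLpLinear_tmul, TensorProduct.inner_tmul,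
        Finset.mul_sum]

lemma tensorPiLpLinear_surjective : Function.Surjective (tensorPiLpLinear K E) := by
  classical
  intro y
  have hsingle : ∀ (i : ι) (t : K ⊗[ℂ] E i),
      ∃ z, tensorPiLpLinear K E z = PiLp.single 2 i t := by
    intro i t
    induction t with
    | zero => exact ⟨0, by ext j; by_cases h : j = i <;> simp⟩
    | add t₁ t₂ h₁ h₂ =>
      obtain ⟨z₁, h₁⟩ := h₁
      obtain ⟨z₂, h₂⟩ := h₂
      refine ⟨z₁ + z₂, ?_⟩
      rw [map_add, h₁, h₂]
      ext j
      by_cases h : j = i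
      · subst h; simp
      · simp [h]
    | tmul k x =>
      refine ⟨k ⊗ₜ PiLp.single 2 i x, ?_⟩
      ext j
      rw [tensorPiLpLinear_tmul]
      by_cases h : j = i
      · subst h; simp
      · simp [h]
  choose f hf using hsingle
  refine ⟨∑ i, f i (y i), ?_⟩
  rw [map_sum]
  simp_rw [hf]
  ext j
  rw [WithLp.ofLp_sum, Finset.sum_apply, Finset.sum_eq_single j]
  · simp
  · intro i _ h; simp [h.symm]
  · simp

/-- The unitary identification `K ⊗ ⨁ᵢ Eᵢ ≃ ⨁ᵢ K ⊗ Eᵢ` for finite direct sums. -/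
noncomputable def tensorPiLp (K : Type*) [NormedAddCommGroup K] [InnerProductSpace ℂ K]
    (E : ι → Type*) [∀ i, NormedAddCommGroup (E i)] [∀ i, InnerProductSpace ℂ (E i)] :
    K ⊗[ℂ] PiLp 2 E ≃ₗᵢ[ℂ] PiLp 2 (fun i => K ⊗[ℂ] E i) :=
  LinearIsometryEquiv.ofSurjective
    ((tensorPiLpLinear K E).isometryOfInner inner_tensorPiLpLinear) tensorPiLpLinear_surjective

lemma tensorPiLp_tmul (k : K) (x : PiLp 2 E) (i : ι) :
    tensorPiLp K E (k ⊗ₜ x) i = k ⊗ₜ x i := rfl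

/-- An operator on `K ⊗ ⨁ᵢ Eᵢ` read as an operator on `⨁ᵢ K ⊗ Eᵢ`. -/
noncomputable def conjTensorPiLp (A : K ⊗[ℂ] PiLp 2 E →L[ℂ] K ⊗[ℂ] PiLp 2 F) :
    PiLp 2 (fun i => K ⊗[ℂ] E i) →L[ℂ] PiLp 2 (fun i => K ⊗[ℂ] F i) :=
  ((tensorPiLp K F).toContinuousLinearEquiv : _ →L[ℂ] _) ∘L A ∘L
    ((tensorPiLp K E).symm.toContinuousLinearEquiv : _ →L[ℂ] _)

lemma conjTensorPiLp_apply (A : K ⊗[ℂ] PiLp 2 E →L[ℂ] K ⊗[ℂ] PiLp 2 F)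
    (z : K ⊗[ℂ] PiLp 2 E) :
    conjTensorPiLp A (tensorPiLp K E z) = tensorPiLp K F (A z) := by
  simp [conjTensorPiLp]

/-- Operators on `⨁ᵢ K ⊗ Eᵢ` are determined by the images of the vectors `(k ⊗ xᵢ)ᵢ`. -/
lemma eq_conjTensorPiLp {A : K ⊗[ℂ] PiLp 2 E →L[ℂ] K ⊗[ℂ] PiLp 2 F}
    {B : PiLp 2 (fun i => K ⊗[ℂ] E i) →L[ℂ] PiLp 2 (fun i => K ⊗[ℂ] F i)}
    (h : ∀ k x, B (tensorPiLp K E (k ⊗ₜ x)) = tensorPiLp K F (A (k ⊗ₜ x))) :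
    B = conjTensorPiLp A := by
  refine ContinuousLinearMap.ext fun y => ?_
  obtain ⟨z, rfl⟩ := (tensorPiLp K E).surjective y
  rw [conjTensorPiLp_apply]
  induction z with
  | zero => simp
  | add z₁ z₂ h₁ h₂ => simp only [map_add, h₁, h₂]
  | tmul k x => exact h k x

lemma conjTensorPiLp_comp (A : K ⊗[ℂ] PiLp 2 F →L[ℂ] K ⊗[ℂ] PiLp 2 T)
    (B : K ⊗[ℂ] PiLp 2 E →L[ℂ] K ⊗[ℂ] PiLp 2 F) :
    conjTensorPiLp (A ∘L B) = conjTensorPiLp A ∘L conjTensorPiLp B := by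
  refine ContinuousLinearMap.ext fun y => ?_
  obtain ⟨z, rfl⟩ := (tensorPiLp K E).surjective y
  simp [conjTensorPiLp_apply]

lemma conjTensorPiLp_id :
    conjTensorPiLp (ContinuousLinearMap.id ℂ (K ⊗[ℂ] PiLp 2 E)) = ContinuousLinearMap.id ℂ _ := by
  refine ContinuousLinearMap.ext fun y => ?_
  obtain ⟨z, rfl⟩ := (tensorPiLp K E).surjective y
  simp [conjTensorPiLp_apply]

lemma conjTensorPiLp_sum {α : Type*} (s : Finset α)
    (A : α → (K ⊗[ℂ] PiLp 2 E →L[ℂ] K ⊗[ℂ] PiLp 2 F)) :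
    conjTensorPiLp (∑ a ∈ s, A a) = ∑ a ∈ s, conjTensorPiLp (A a) := by
  refine ContinuousLinearMap.ext fun y => ?_
  obtain ⟨z, rfl⟩ := (tensorPiLp K E).surjective y
  simp [conjTensorPiLp_apply]

/-- The ampliation `I_K ⊗ A` of an operator between finite direct sums. -/
noncomputable def ampliation (K : Type*) [NormedAddCommGroup K] [InnerProductSpace ℂ K]
    (A : PiLp 2 E →L[ℂ] PiLp 2 F) :
    PiLp 2 (fun i => K ⊗[ℂ] E i) →L[ℂ] PiLp 2 (fun i => K ⊗[ℂ] F i) :=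
  conjTensorPiLp (A.lTensor K)

lemma ampliation_comp (A : PiLp 2 F →L[ℂ] PiLp 2 T) (B : PiLp 2 E →L[ℂ] PiLp 2 F) :
    ampliation K (A ∘L B) = ampliation K A ∘L ampliation K B := by
  rw [ampliation, ContinuousLinearMap.lTensor_comp, conjTensorPiLp_comp]; rfl

lemma ampliation_id :
    ampliation K (ContinuousLinearMap.id ℂ (PiLp 2 E)) = ContinuousLinearMap.id ℂ _ := by
  rw [ampliation, ContinuousLinearMap.lTensor_id, conjTensorPiLp_id]

lemma norm_ampliation_le (A : PiLp 2 E →L[ℂ] PiLp 2 F) : ‖ampliation K A‖ ≤ ‖A‖ := by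
  refine ContinuousLinearMap.opNorm_le_bound _ (norm_nonneg A) fun y => ?_
  obtain ⟨z, rfl⟩ := (tensorPiLp K E).surjective y
  rw [ampliation, conjTensorPiLp_apply, LinearIsometryEquiv.norm_map,
    LinearIsometryEquiv.norm_map]
  exact ((A.lTensor K).le_opNorm z).trans
    (mul_le_mul_of_nonneg_right (ContinuousLinearMap.norm_lTensor_le (G := K) A) (norm_nonneg _))

/-- The ampliation of a unit of the algebra of operators on a finite direct sum. -/
noncomputable def ampliationUnit (K : Type*) [NormedAddCommGroup K] [InnerProductSpace ℂ K]
    (X : (PiLp 2 E →L[ℂ] PiLp 2 E)ˣ) :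
    (PiLp 2 (fun i => K ⊗[ℂ] E i) →L[ℂ] PiLp 2 (fun i => K ⊗[ℂ] E i))ˣ where
  val := ampliation K (X : PiLp 2 E →L[ℂ] PiLp 2 E)
  inv := ampliation K ((X⁻¹ : (PiLp 2 E →L[ℂ] PiLp 2 E)ˣ) : PiLp 2 E →L[ℂ] PiLp 2 E)
  val_inv := by
    rw [ContinuousLinearMap.mul_def, ← ampliation_comp, ← ContinuousLinearMap.mul_def,
      Units.mul_inv, ContinuousLinearMap.one_def, ampliation_id]; rfl
  inv_val := by
    rw [ContinuousLinearMap.mul_def, ← ampliation_comp, ← ContinuousLinearMap.mul_def,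
      Units.inv_mul, ContinuousLinearMap.one_def, ampliation_id]; rfl

end Ampliation

section Coordinates

variable {K : Type*} [NormedAddCommGroup K] [InnerProductSpace ℂ K]
  {H : Type*} [NormedAddCommGroup H] [InnerProductSpace ℂ H] {n : Type*} [Fintype n]

/-- An orthonormal basis of `H`, indexed by `n`, identifies `K ⊗ H` with `Kⁿ`. -/
noncomputable def tensorCoord (K : Type*) [NormedAddCommGroup K] [InnerProductSpace ℂ K]
    (b : OrthonormalBasis n ℂ H) : K ⊗[ℂ] H ≃ₗᵢ[ℂ] PiLp 2 (fun _ : n => K) :=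
  ((LinearIsometryEquiv.lTensor K b.repr).trans (tensorPiLp K fun _ : n => ℂ)).trans
    (LinearIsometryEquiv.piLpCongrRight 2 fun _ => TensorProduct.ridIsometry ℂ K)

lemma tensorCoord_tmul (b : OrthonormalBasis n ℂ H) (k : K) (h : H) (j : n) :
    tensorCoord K b (k ⊗ₜ h) j = b.repr h j • k := by
  simp [tensorCoord, tensorPiLp_tmul]

lemma tensorCoord_mapL (b : OrthonormalBasis n ℂ H) (W : K →L[ℂ] K) (z : K ⊗[ℂ] H) (j : n) :
    tensorCoord K b (TensorProduct.mapL W (ContinuousLinearMap.id ℂ H) z) j =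
      W (tensorCoord K b z j) := by
  induction z with
  | zero => simp
  | add z₁ z₂ h₁ h₂ => simp only [map_add, PiLp.add_apply, h₁, h₂]
  | tmul k h => simp [tensorCoord_tmul]

lemma completeSpace_tensor_finiteDimensional [CompleteSpace K] [FiniteDimensional ℂ H] :
    CompleteSpace (K ⊗[ℂ] H) :=
  (completeSpace_congr (e := (tensorCoord K (stdOrthonormalBasis ℂ H)).toEquiv)
    (tensorCoord K (stdOrthonormalBasis ℂ H)).isometry.isUniformEmbedding).2 inferInstance

end Coordinates

/-! ### Block structure and the similarity bound -/

namespace AdmissibleGraph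

variable {V : Type*} {G : AdmissibleGraph V}

/-- The edge joining two given vertices of a component; it exists because components are complete
bipartite. -/
def edgeOf {p : G.Comp} (s : G.Src p) (r : G.Rng p) : G.Edge p :=
  ⟨(s, r), G.complete s.1 s.2.1 r.1 r.2.1
    (SimpleGraph.ConnectedComponent.exact (s.2.2.trans r.2.2.symm))⟩

/-- The edges of a component are the pairs of a source and a range vertex. -/
def edgeEquiv (p : G.Comp) : G.Src p × G.Rng p ≃ G.Edge p where
  toFun x := edgeOf x.1 x.2
  invFun e := (e.src, e.rng)
  left_inv _ := rfl
  right_inv _ := rfl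

section Blocks

variable {H : G.Comp → Type*} [∀ p, NormedAddCommGroup (H p)] [∀ p, InnerProductSpace ℂ (H p)]

lemma srcProj_apply {p : G.Comp} (s : G.Src p) (x : G.SrcSpace H) :
    G.srcProj H s x = x ⟨p, s⟩ := rfl

lemma rngProj_apply {p : G.Comp} (r : G.Rng p) (x : G.RngSpace H) :
    G.rngProj H r x = x ⟨p, r⟩ := rfl

lemma srcIncl_apply_self {p : G.Comp} (s : G.Src p) (v : H p) :
    G.srcIncl H s v ⟨p, s⟩ = v := by
  simp [srcIncl]

lemma srcIncl_apply_of_ne {p : G.Comp} (s : G.Src p) (v : H p) {i : (p : G.Comp) × G.Src p}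
    (h : i ≠ ⟨p, s⟩) : G.srcIncl H s v i = 0 := by
  simp only [srcIncl]
  classical
  exact Pi.single_eq_of_ne (M := fun i : (p : G.Comp) × G.Src p => H i.1) h v

lemma rngIncl_apply_self {p : G.Comp} (r : G.Rng p) (v : H p) :
    G.rngIncl H r v ⟨p, r⟩ = v := by
  simp [rngIncl]

lemma rngIncl_apply_of_ne {p : G.Comp} (r : G.Rng p) (v : H p) {i : (p : G.Comp) × G.Rng p}
    (h : i ≠ ⟨p, r⟩) : G.rngIncl H r v i = 0 := by
  simp only [rngIncl]
  classical
  exact Pi.single_eq_of_ne (M := fun i : (p : G.Comp) × G.Rng p => H i.1) h v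

variable [Finite V]

lemma sum_srcIncl_apply (v : ∀ i : (p : G.Comp) × G.Src p, H i.1) (i : (p : G.Comp) × G.Src p) :
    (∑ p, ∑ s : G.Src p, G.srcIncl H s (v ⟨p, s⟩)) i = v i := by
  rw [← Fintype.sum_sigma' (fun p (s : G.Src p) => G.srcIncl H s (v ⟨p, s⟩)),
    WithLp.ofLp_sum, Finset.sum_apply, Finset.sum_eq_single i]
  · exact srcIncl_apply_self i.2 _
  · intro j _ h
    exact srcIncl_apply_of_ne j.2 _ h.symm
  · simp

lemma sum_rngIncl_apply (v : ∀ i : (p : G.Comp) × G.Rng p, H i.1) (i : (p : G.Comp) × G.Rng p) :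
    (∑ p, ∑ r : G.Rng p, G.rngIncl H r (v ⟨p, r⟩)) i = v i := by
  rw [← Fintype.sum_sigma' (fun p (r : G.Rng p) => G.rngIncl H r (v ⟨p, r⟩)),
    WithLp.ofLp_sum, Finset.sum_apply, Finset.sum_eq_single i]
  · exact rngIncl_apply_self i.2 _
  · intro j _ h
    exact rngIncl_apply_of_ne j.2 _ h.symm
  · simp

lemma srcDiag_apply (Γ : ∀ p, H p →L[ℂ] H p) (x : G.SrcSpace H) (i : (p : G.Comp) × G.Src p) :
    G.srcDiag Γ x i = Γ i.1 (x i) := by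
  rw [← sum_srcIncl_apply (fun i => Γ i.1 (x i)) i]
  simp [srcDiag, srcProj_apply]

lemma rngDiag_apply (Γ : ∀ p, H p →L[ℂ] H p) (x : G.RngSpace H) (i : (p : G.Comp) × G.Rng p) :
    G.rngDiag Γ x i = Γ i.1 (x i) := by
  rw [← sum_rngIncl_apply (fun i => Γ i.1 (x i)) i]
  simp [rngDiag, rngProj_apply]

lemma pencil_apply (Z : ∀ p, G.Edge p → (H p →L[ℂ] H p)) (x : G.RngSpace H)
    (i : (p : G.Comp) × G.Src p) :
    G.pencil Z x i = ∑ r : G.Rng i.1, Z i.1 (edgeOf i.2 r) (x ⟨i.1, r⟩) := by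
  have h : G.pencil Z x = ∑ p, ∑ s : G.Src p, G.srcIncl H s
      (∑ r : G.Rng p, Z p (edgeOf s r) (x ⟨p, r⟩)) := by
    simp only [pencil, _root_.sum_apply, ContinuousLinearMap.comp_apply, rngProj_apply]
    refine Finset.sum_congr rfl fun p _ => ?_
    rw [← (edgeEquiv p).sum_comp, Fintype.sum_prod_type]
    exact Finset.sum_congr rfl fun s _ => by rw [map_sum]; rfl
  rw [h]
  exact sum_srcIncl_apply (fun i => ∑ r : G.Rng i.1, Z i.1 (edgeOf i.2 r) (x ⟨i.1, r⟩)) i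

/-- Pairs of block diagonal operators with the same blocks intertwine every pencil with scalar
coefficients. -/
lemma diag_mem_intertwiners (Γ : ∀ p, H p →L[ℂ] H p) :
    (G.rngDiag Γ, G.srcDiag Γ) ∈ intertwiners (G.classicalUncertainty H) := by
  rintro D ⟨Z, hZ, rfl⟩
  refine ContinuousLinearMap.ext fun x => PiLp.ext fun i => ?_
  rw [ContinuousLinearMap.comp_apply, ContinuousLinearMap.comp_apply, pencil_apply, srcDiag_apply,
    pencil_apply, map_sum]
  refine Finset.sum_congr rfl fun r _ => ?_
  obtain ⟨c, hc⟩ := hZ i.1 (edgeOf i.2 r)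
  rw [← hc, rngDiag_apply]
  simp

/-- The elementary operators `ι_s ι_r^*` lie in the classical uncertainty set. -/
lemma single_edge_mem_classicalUncertainty {p : G.Comp} (e : G.Edge p) :
    G.srcIncl H e.src ∘L G.rngProj H e.rng ∈ G.classicalUncertainty H := by
  classical
  refine ⟨fun q f => (if (⟨q, f⟩ : (p : G.Comp) × G.Edge p) = ⟨p, e⟩ then (1 : ℂ) else 0) •
    ContinuousLinearMap.id ℂ (H q), fun q f => ⟨_, rfl⟩, ?_⟩
  rw [pencil, ← Fintype.sum_sigma' (fun q (f : G.Edge q) => G.srcIncl H f.src ∘L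
    ((if (⟨q, f⟩ : (p : G.Comp) × G.Edge p) = ⟨p, e⟩ then (1 : ℂ) else 0) •
      ContinuousLinearMap.id ℂ (H q)) ∘L G.rngProj H f.rng), Finset.sum_eq_single ⟨p, e⟩]
  · simp
  · intro j _ h
    simp [h]
  · simp

end Blocks

section Enhanced

variable [Finite V]
variable {H : G.Comp → Type*} [∀ p, NormedAddCommGroup (H p)] [∀ p, InnerProductSpace ℂ (H p)]
  {K : Type*} [NormedAddCommGroup K] [InnerProductSpace ℂ K]

/-- The operator `I_K ⊗ M`, given by its blocks, is the ampliation of `M` transported along the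
unitary `tensorPiLp`. -/
lemma idTensor_eq_ampliation (M : G.SrcSpace H →L[ℂ] G.RngSpace H) :
    G.idTensor K M = ampliation K M := by
  refine eq_conjTensorPiLp fun k x => PiLp.ext fun i => ?_
  rw [ContinuousLinearMap.lTensor_tmul, tensorPiLp_tmul]
  have hx : x = ∑ p, ∑ s : G.Src p, G.srcIncl H s (x ⟨p, s⟩) :=
    PiLp.ext fun i => (sum_srcIncl_apply (fun i => x i) i).symm
  conv_rhs => rw [hx]
  rw [← sum_rngIncl_apply (H := fun p => K ⊗[ℂ] H p)
    (fun i => k ⊗ₜ (M (∑ p, ∑ s : G.Src p, G.srcIncl H s (x ⟨p, s⟩))) i) i]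
  refine congrArg (fun y : G.RngSpace (fun p => K ⊗[ℂ] H p) => y i) ?_
  simp only [idTensor, _root_.sum_apply]
  refine Finset.sum_congr rfl fun p _ => Finset.sum_congr rfl fun r _ => ?_
  simp [srcProj_apply, tensorPiLp_tmul, rngProj_apply, TensorProduct.tmul_sum]

lemma srcIncl_comp_mapL_comp_rngProj {p : G.Comp} (s : G.Src p) (r : G.Rng p) (W : K →L[ℂ] K) :
    G.srcIncl (fun p => K ⊗[ℂ] H p) s ∘L TensorProduct.mapL W (ContinuousLinearMap.id ℂ (H p)) ∘L
        G.rngProj (fun p => K ⊗[ℂ] H p) r =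
      conjTensorPiLp (TensorProduct.mapL W (G.srcIncl H s ∘L G.rngProj H r)) := by
  refine eq_conjTensorPiLp fun k x => PiLp.ext fun i => ?_
  rw [TensorProduct.mapL_tmul, tensorPiLp_tmul]
  simp only [ContinuousLinearMap.comp_apply, rngProj_apply, tensorPiLp_tmul,
    TensorProduct.mapL_tmul, ContinuousLinearMap.id_apply]
  by_cases h : i = ⟨p, s⟩
  · subst h
    rw [srcIncl_apply_self, srcIncl_apply_self]
  · rw [srcIncl_apply_of_ne _ _ h, srcIncl_apply_of_ne _ _ h, TensorProduct.tmul_zero]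

/-- The ampliation of an intertwining pair for the classical uncertainty set intertwines the
enhanced uncertainty set. -/
lemma ampliation_mem_intertwiners {X : G.RngSpace H →L[ℂ] G.RngSpace H}
    {Y : G.SrcSpace H →L[ℂ] G.SrcSpace H}
    (h : (X, Y) ∈ intertwiners (G.classicalUncertainty H)) :
    (ampliation K X, ampliation K Y) ∈ intertwiners (G.enhancedUncertainty H K) := by
  rintro D ⟨Z, hZ, rfl⟩
  choose W hW using hZ
  have hD : G.pencil Z = conjTensorPiLp (∑ p, ∑ e : G.Edge p,
      TensorProduct.mapL (W p e) (G.srcIncl H e.src ∘L G.rngProj H e.rng)) := by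
    simp only [pencil, conjTensorPiLp_sum, ← srcIncl_comp_mapL_comp_rngProj]
    simp only [← hW]
  rw [hD, ampliation, ampliation, ← conjTensorPiLp_comp, ← conjTensorPiLp_comp]
  congr 1
  simp only [ContinuousLinearMap.lTensor_eq_mapL, ContinuousLinearMap.finsetSum_comp,
    ContinuousLinearMap.comp_finsetSum, ← TensorProduct.mapL_comp]
  refine Finset.sum_congr rfl fun p _ => Finset.sum_congr rfl fun e _ => ?_
  rw [h _ (single_edge_mem_classicalUncertainty e), ContinuousLinearMap.comp_id,
    ContinuousLinearMap.id_comp]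

/-- The easy inequality: an intertwining pair of invertible operators turns `(I ⊗ M) D` into the
similar operator `(I ⊗ X M Y⁻¹) D`, whose spectral radius is at most `‖X M Y⁻¹‖ ‖D‖`. -/
theorem structuredSingularValue_le_scalingBound [∀ p, FiniteDimensional ℂ (H p)] [CompleteSpace K]
    (M : G.SrcSpace H →L[ℂ] G.RngSpace H) :
    structuredSingularValue (G.enhancedUncertainty H K) (G.idTensor K M) ≤
      scalingBound (G.classicalUncertainty H) M := by
  have hcomp : ∀ p, CompleteSpace (K ⊗[ℂ] H p) := fun p => completeSpace_tensor_finiteDimensional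
  refine le_iInf fun X => le_iInf fun Y => le_iInf fun hXY => ?_
  set N : G.SrcSpace H →L[ℂ] G.RngSpace H := (X : G.RngSpace H →L[ℂ] G.RngSpace H) ∘L M ∘L
    ((Y⁻¹ : (G.SrcSpace H →L[ℂ] G.SrcSpace H)ˣ) : G.SrcSpace H →L[ℂ] G.SrcSpace H) with hN
  rw [structuredSingularValue, ENNReal.inv_le_iff_inv_le]
  refine le_iInf₂ fun D hD => ?_
  obtain ⟨hD, hspec⟩ := hD
  have hint := ampliation_mem_intertwiners (K := K) hXY D hD
  have hNY : N ∘L (Y : G.SrcSpace H →L[ℂ] G.SrcSpace H) =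
      (X : G.RngSpace H →L[ℂ] G.RngSpace H) ∘L M := by
    rw [hN, ContinuousLinearMap.comp_assoc, ContinuousLinearMap.comp_assoc,
      ← ContinuousLinearMap.mul_def (Y⁻¹).val, Units.inv_mul]
    rfl
  have hconj : (ampliationUnit K X).val *
      (G.idTensor K M ∘L D) * ((ampliationUnit K X)⁻¹).val = ampliation K N ∘L D := by
    rw [Units.mul_inv_eq_iff_eq_mul]
    change ampliation K X.val ∘L (G.idTensor K M ∘L D) =
      (ampliation K N ∘L D) ∘L ampliation K X.val
    rw [ContinuousLinearMap.comp_assoc _ D, hint, idTensor_eq_ampliation,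
      ← ContinuousLinearMap.comp_assoc, ← ContinuousLinearMap.comp_assoc, ← ampliation_comp,
      ← ampliation_comp, hNY]
  rw [← spectrum.units_conjugate (u := ampliationUnit K X), hconj] at hspec
  have h1 := spectrum.norm_le_norm_mul_of_mem hspec
  rw [norm_one] at h1
  have h2 : (1 : ℝ) ≤ ‖N‖ * ‖D‖ :=
    calc (1 : ℝ) ≤ ‖ampliation K N ∘L D‖ * ‖(1 : G.RngSpace (fun p => K ⊗[ℂ] H p) →L[ℂ] _)‖ := h1
      _ ≤ ‖ampliation K N ∘L D‖ * 1 :=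
        mul_le_mul_of_nonneg_left ContinuousLinearMap.norm_id_le (norm_nonneg _)
      _ ≤ ‖N‖ * ‖D‖ := by
        rw [mul_one]
        exact (ContinuousLinearMap.opNorm_comp_le _ _).trans
          (mul_le_mul_of_nonneg_right (norm_ampliation_le N) (norm_nonneg _))
  rw [ENNReal.inv_le_iff_le_mul (by simp) (by simp), ← ofReal_norm, ← ofReal_norm,
    ← ENNReal.ofReal_mul (norm_nonneg _), ← ENNReal.ofReal_one]
  exact ENNReal.ofReal_le_ofReal h2

end Enhanced

end AdmissibleGraph

/-! ### Strict positivity and scaling by square roots -/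

section Positivity

variable {E F : Type*} [NormedAddCommGroup E] [InnerProductSpace ℂ E] [CompleteSpace E]
  [NormedAddCommGroup F] [InnerProductSpace ℂ F]

/-- A self-adjoint operator that is bounded below is strictly positive. -/
lemma isStrictlyPositive_of_forall_le {A : E →L[ℂ] E} (hA : IsSelfAdjoint A) {ε : ℝ} (hε : 0 < ε)
    (h : ∀ x, ε * ‖x‖ ^ 2 ≤ (inner ℂ (A x) x).re) : IsStrictlyPositive A := by
  refine IsUnit.isStrictlyPositive ?_ ?_
  · refine ContinuousLinearMap.isUnit_of_forall_le_norm_inner_map A (c := ⟨ε, hε.le⟩) hε fun x => ?_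
    rw [mul_comm]
    exact (h x).trans (Complex.re_le_norm _)
  · rw [ContinuousLinearMap.nonneg_iff_isPositive, ContinuousLinearMap.isPositive_def']
    exact ⟨hA, fun x => le_trans (by positivity) (h x)⟩

/-- A strictly positive operator is bounded below. -/
lemma IsStrictlyPositive.exists_forall_le {A : E →L[ℂ] E} (hA : IsStrictlyPositive A) :
    ∃ ε : ℝ, 0 < ε ∧ ∀ x, ε * ‖x‖ ^ 2 ≤ (inner ℂ (A x) x).re := by
  rcases subsingleton_or_nontrivial E with hE | hE
  · exact ⟨1, one_pos, fun x => by simp [Subsingleton.elim x 0]⟩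
  · obtain ⟨r, hr, hle⟩ : ∃ r > 0, algebraMap ℝ (E →L[ℂ] E) r ≤ A :=
      (CFC.exists_pos_algebraMap_le_iff hA.isSelfAdjoint).2 fun x hx => hA.spectrum_pos hx
    refine ⟨r, hr, fun x => ?_⟩
    have := (ContinuousLinearMap.le_def _ _ |>.1 hle).re_inner_nonneg_left x
    rw [sub_apply, inner_sub_left, map_sub, sub_nonneg, Algebra.algebraMap_eq_smul_one,
      smul_apply, one_apply_eq_self, ← Complex.coe_smul, inner_smul_left,
      inner_self_eq_norm_sq_to_K] at this
    simpa [← Complex.ofReal_pow, ← Complex.ofReal_mul] using this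

/-- If `D` intertwines two squares of strictly positive operators on finite-dimensional spaces,
then it intertwines the operators. The defect `C = D A - B D` solves the Sylvester equation
`B C = - C A`, and `A`, `-B` have no common eigenvalue. -/
lemma intertwines_of_intertwines_sq [FiniteDimensional ℂ E] {A : E →L[ℂ] E} {B : F →L[ℂ] F}
    (hA : IsStrictlyPositive A) (hB : 0 ≤ B) {D : E →L[ℂ] F}
    (h : D ∘L (A * A) = (B * B) ∘L D) : D ∘L A = B ∘L D := by
  have hsymm : (A : E →ₗ[ℂ] E).IsSymmetric :=
    (ContinuousLinearMap.isSelfAdjoint_iff_isSymmetric.1 hA.isSelfAdjoint)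
  obtain ⟨ε, hε, hle⟩ := hA.exists_forall_le
  suffices hb : ∀ i, D (A (hsymm.eigenvectorBasis rfl i)) = B (D (hsymm.eigenvectorBasis rfl i)) by
    have : ((D ∘L A : E →L[ℂ] F) : E →ₗ[ℂ] F) = ((B ∘L D : E →L[ℂ] F) : E →ₗ[ℂ] F) :=
      (hsymm.eigenvectorBasis rfl).toBasis.ext fun i => by simpa using hb i
    exact ContinuousLinearMap.coe_injective this
  intro i
  set v := hsymm.eigenvectorBasis rfl i with hv
  set t : ℝ := hsymm.eigenvalues rfl i
  have hAv : A v = (t : ℂ) • v := hsymm.apply_eigenvectorBasis rfl i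
  have hv1 : ‖v‖ = 1 := (hsymm.eigenvectorBasis rfl).norm_eq_one i
  have ht : 0 < t := by
    have := hle v
    rw [hAv, inner_smul_left, inner_self_eq_norm_sq_to_K, hv1] at this
    simp at this
    linarith
  -- `c = D A v - B D v` satisfies `B c = - t c`, which is incompatible with `0 ≤ B` unless `c = 0`
  set c := D (A v) - B (D v) with hc
  have hBc : B c = -((t : ℂ) • c) := by
    have h1 : D (A (A v)) = B (B (D v)) := by simpa using congrArg (fun T => T v) h
    rw [hc, map_sub, ← h1, hAv]
    simp only [map_smul, hAv, smul_sub, neg_sub]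
  have hpos := (ContinuousLinearMap.nonneg_iff_isPositive B |>.1 hB).re_inner_nonneg_left c
  rw [hBc, inner_neg_left, inner_smul_left, inner_self_eq_norm_sq_to_K] at hpos
  have h2 : t * ‖c‖ ^ 2 ≤ 0 := by
    have : -(t * ‖c‖ ^ 2) ≥ 0 := by
      simpa [← Complex.ofReal_pow, ← Complex.ofReal_mul] using hpos
    linarith
  have h3 : ‖c‖ ^ 2 = 0 := le_antisymm (by nlinarith [sq_nonneg ‖c‖]) (sq_nonneg _)
  exact sub_eq_zero.1 (norm_eq_zero.1 (pow_eq_zero_iff two_ne_zero |>.1 h3))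

variable [CompleteSpace F]

/-- A strictly feasible intertwining pair `(X, Y)` for the matrix inequality `M* X M < Y` gives, by
scaling with the square roots of `X` and `Y`, a strict contraction. -/
theorem scalingBound_lt_one [FiniteDimensional ℂ E] [FiniteDimensional ℂ F]
    {𝓓 : Set (E →L[ℂ] F)} {M : F →L[ℂ] E} {X : E →L[ℂ] E} {Y : F →L[ℂ] F}
    (hXY : (X, Y) ∈ intertwiners 𝓓) (hX : IsStrictlyPositive X) (hY : IsStrictlyPositive Y)
    (hM : IsStrictlyPositive (Y - ContinuousLinearMap.adjoint M ∘L X ∘L M)) :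
    scalingBound 𝓓 M < 1 := by
  obtain ⟨A, hA, rfl⟩ : ∃ A : E →L[ℂ] E, IsStrictlyPositive A ∧ X = A * A :=
    (CStarAlgebra.isStrictlyPositive_TFAE.out 0 3).1 hX
  obtain ⟨B, hB, rfl⟩ : ∃ B : F →L[ℂ] F, IsStrictlyPositive B ∧ Y = B * B :=
    (CStarAlgebra.isStrictlyPositive_TFAE.out 0 3).1 hY
  obtain ⟨a, ha⟩ := hA.isUnit
  obtain ⟨b, hb⟩ := hB.isUnit
  have hab : ((a : E →L[ℂ] E), (b : F →L[ℂ] F)) ∈ intertwiners 𝓓 := fun D hD => by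
    rw [ha, hb]
    exact intertwines_of_intertwines_sq hA hB.nonneg (hXY D hD)
  obtain ⟨ε, hε, hle⟩ := hM.exists_forall_le
  set N : F →L[ℂ] E := (a : E →L[ℂ] E) ∘L M ∘L ((b⁻¹ : (F →L[ℂ] F)ˣ) : F →L[ℂ] F) with hN
  -- `δ` makes `δ ‖B x‖² ≤ ε ‖x‖²`; the summand `ε` keeps the denominator positive and `δ ≤ 1`
  set δ : ℝ := ε / (ε + ‖B‖ ^ 2) with hδ
  have hden : 0 < ε + ‖B‖ ^ 2 := by positivity
  have hδ0 : 0 < δ := by positivity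
  have hδ1 : δ ≤ 1 := by rw [hδ, div_le_one hden]; nlinarith [sq_nonneg ‖B‖]
  have hbound : ∀ y, ‖N y‖ ^ 2 ≤ (1 - δ) * ‖y‖ ^ 2 := by
    intro y
    set x := ((b⁻¹ : (F →L[ℂ] F)ˣ) : F →L[ℂ] F) y with hx
    have hy : y = B x := by
      rw [hx, ← hb, ← mul_apply_eq_comp, Units.mul_inv, one_apply_eq_self]
    have hNy : N y = A (M x) := by rw [← ha]; rfl
    have h1 := hle x
    have hAA : inner ℂ (ContinuousLinearMap.adjoint M (A (A (M x)))) x =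
        inner ℂ (A (M x)) (A (M x)) := by
      rw [ContinuousLinearMap.adjoint_inner_left,
        (ContinuousLinearMap.isSelfAdjoint_iff_isSymmetric.1 hA.isSelfAdjoint).apply_clm]
    have hBB : inner ℂ (B (B x)) x = inner ℂ (B x) (B x) :=
      (ContinuousLinearMap.isSelfAdjoint_iff_isSymmetric.1 hB.isSelfAdjoint) _ _
    have h2 : (inner ℂ ((B * B - ContinuousLinearMap.adjoint M ∘L (A * A) ∘L M) x) x).re =
        ‖y‖ ^ 2 - ‖N y‖ ^ 2 := by
      rw [sub_apply, inner_sub_left, Complex.sub_re]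
      change (inner ℂ (B (B x)) x).re -
        (inner ℂ (ContinuousLinearMap.adjoint M (A (A (M x)))) x).re = _
      rw [hAA, hBB, ← hy, ← hNy]
      congr 1 <;> exact inner_self_eq_norm_sq (𝕜 := ℂ) _
    rw [h2] at h1
    have h3 : ‖y‖ ≤ ‖B‖ * ‖x‖ := hy ▸ B.le_opNorm x
    have h4 : ‖y‖ ^ 2 ≤ ‖B‖ ^ 2 * ‖x‖ ^ 2 := by
      rw [← mul_pow]; exact pow_le_pow_left₀ (norm_nonneg _) h3 2
    have h5 : δ * ‖y‖ ^ 2 ≤ ε * ‖x‖ ^ 2 := by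
      rw [hδ, div_mul_eq_mul_div, div_le_iff₀ hden]
      nlinarith [mul_le_mul_of_nonneg_left h4 hε.le, mul_nonneg (mul_nonneg hε.le hε.le)
        (sq_nonneg ‖x‖)]
    linarith
  have hnorm : ‖N‖ ≤ Real.sqrt (1 - δ) := by
    refine ContinuousLinearMap.opNorm_le_bound _ (Real.sqrt_nonneg _) fun y => ?_
    rw [← Real.sqrt_sq (norm_nonneg y), ← Real.sqrt_mul (by linarith)]
    exact Real.le_sqrt_of_sq_le (hbound y)
  have hlt : ‖N‖ < 1 := hnorm.trans_lt (by
    rw [Real.sqrt_lt' one_pos]; linarith)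
  refine lt_of_le_of_lt (iInf_le_of_le a (iInf_le_of_le b (iInf_le _ hab))) ?_
  rw [← hN, ← ofReal_norm, ← ENNReal.ofReal_one]
  exact (ENNReal.ofReal_lt_ofReal_iff one_pos).2 hlt

end Positivity

namespace AdmissibleGraph

variable {V : Type*} {G : AdmissibleGraph V} [Finite V]
  {H : G.Comp → Type*} [∀ p, NormedAddCommGroup (H p)] [∀ p, InnerProductSpace ℂ (H p)]
  [∀ p, CompleteSpace (H p)]

lemma isSelfAdjoint_srcDiag {Γ : ∀ p, H p →L[ℂ] H p} (h : ∀ p, IsSelfAdjoint (Γ p)) :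
    IsSelfAdjoint (G.srcDiag Γ) := by
  rw [ContinuousLinearMap.isSelfAdjoint_iff_isSymmetric]
  intro x y
  simp only [ContinuousLinearMap.coe_coe, PiLp.inner_apply, srcDiag_apply]
  exact Finset.sum_congr rfl fun i _ =>
    ContinuousLinearMap.isSelfAdjoint_iff_isSymmetric.1 (h i.1) _ _

lemma isSelfAdjoint_rngDiag {Γ : ∀ p, H p →L[ℂ] H p} (h : ∀ p, IsSelfAdjoint (Γ p)) :
    IsSelfAdjoint (G.rngDiag Γ) := by
  rw [ContinuousLinearMap.isSelfAdjoint_iff_isSymmetric]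
  intro x y
  simp only [ContinuousLinearMap.coe_coe, PiLp.inner_apply, rngDiag_apply]
  exact Finset.sum_congr rfl fun i _ =>
    ContinuousLinearMap.isSelfAdjoint_iff_isSymmetric.1 (h i.1) _ _

lemma exists_uniform_lower_bound {Γ : ∀ p, H p →L[ℂ] H p} (h : ∀ p, IsStrictlyPositive (Γ p)) :
    ∃ ε : ℝ, 0 < ε ∧ ∀ p x, ε * ‖x‖ ^ 2 ≤ (inner ℂ (Γ p x) x).re := by
  choose e he hle using fun p => (h p).exists_forall_le
  have hev : ∀ᶠ ε : ℝ in nhdsWithin 0 (Set.Ioi 0), 0 < ε ∧ ∀ p, ε ≤ e p := by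
    refine Filter.Eventually.and self_mem_nhdsWithin (Filter.eventually_all.2 fun p => ?_)
    exact mem_nhdsWithin_of_mem_nhds (Iic_mem_nhds (he p))
  obtain ⟨ε, hε, hεe⟩ := hev.exists
  exact ⟨ε, hε, fun p x => (mul_le_mul_of_nonneg_right (hεe p) (sq_nonneg _)).trans (hle p x)⟩

lemma isStrictlyPositive_srcDiag {Γ : ∀ p, H p →L[ℂ] H p} (h : ∀ p, IsStrictlyPositive (Γ p)) :
    IsStrictlyPositive (G.srcDiag Γ) := by
  obtain ⟨ε, hε, hle⟩ := exists_uniform_lower_bound h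
  refine isStrictlyPositive_of_forall_le (isSelfAdjoint_srcDiag fun p => (h p).isSelfAdjoint) hε
    fun x => ?_
  simp only [PiLp.norm_sq_eq_of_L2, PiLp.inner_apply, srcDiag_apply, Finset.mul_sum,
    Complex.re_sum]
  exact Finset.sum_le_sum fun i _ => hle i.1 _

lemma isStrictlyPositive_rngDiag {Γ : ∀ p, H p →L[ℂ] H p} (h : ∀ p, IsStrictlyPositive (Γ p)) :
    IsStrictlyPositive (G.rngDiag Γ) := by
  obtain ⟨ε, hε, hle⟩ := exists_uniform_lower_bound h
  refine isStrictlyPositive_of_forall_le (isSelfAdjoint_rngDiag fun p => (h p).isSelfAdjoint) hε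
    fun x => ?_
  simp only [PiLp.norm_sq_eq_of_L2, PiLp.inner_apply, rngDiag_apply, Finset.mul_sum,
    Complex.re_sum]
  exact Finset.sum_le_sum fun i _ => hle i.1 _

end AdmissibleGraph

/-! ### Separation and the alternative to the matrix inequality -/

section DensityOperators

variable {E : Type*} [NormedAddCommGroup E] [InnerProductSpace ℂ E]

/-- The density operators (quantum states) on a finite-dimensional space: the positive operators of
trace one. -/
def densityOperators (E : Type*) [NormedAddCommGroup E] [InnerProductSpace ℂ E] :
    Set (E →L[ℂ] E) :=
  {T | T.IsPositive ∧ LinearMap.trace ℂ E (T : E →ₗ[ℂ] E) = 1}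

lemma convex_densityOperators : Convex ℝ (densityOperators E) := by
  rintro T ⟨hT, hT1⟩ S ⟨hS, hS1⟩ a b ha hb hab
  rw [← Complex.coe_smul, ← Complex.coe_smul]
  refine ⟨(hT.smul_of_nonneg (by simpa using ha)).add (hS.smul_of_nonneg (by simpa using hb)), ?_⟩
  rw [ContinuousLinearMap.toLinearMap_add, ContinuousLinearMap.toLinearMap_smul,
    ContinuousLinearMap.toLinearMap_smul, map_add, map_smul, map_smul, hT1, hS1]
  simp only [smul_eq_mul, mul_one]
  exact_mod_cast hab

variable [FiniteDimensional ℂ E]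

lemma trace_sum_rankOne {m : ℕ} (u : Fin m → E) :
    LinearMap.trace ℂ E ((∑ i, InnerProductSpace.rankOne ℂ (u i) (u i) : E →L[ℂ] E) : E →ₗ[ℂ] E) =
      ((∑ i, ‖u i‖ ^ 2 : ℝ) : ℂ) := by
  rw [ContinuousLinearMap.toLinearMap_sum, map_sum]
  push_cast
  refine Finset.sum_congr rfl fun i _ => ?_
  rw [InnerProductSpace.trace_rankOne, inner_self_eq_norm_sq_to_K]
  rfl

lemma rankOne_self_mem_densityOperators {h : E} (hh : ‖h‖ = 1) :
    InnerProductSpace.rankOne ℂ h h ∈ densityOperators E := by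
  refine ⟨InnerProductSpace.isPositive_rankOne_self h, ?_⟩
  simpa [hh] using trace_sum_rankOne (fun _ : Fin 1 => h)

lemma exists_eq_sum_rankOne_of_mem_densityOperators {T : E →L[ℂ] E}
    (hT : T ∈ densityOperators E) : ∃ (m : ℕ) (u : Fin m → E),
      T = ∑ i, InnerProductSpace.rankOne ℂ (u i) (u i) ∧ ∑ i, ‖u i‖ ^ 2 = 1 := by
  obtain ⟨m, u, rfl⟩ := ContinuousLinearMap.isPositive_iff_eq_sum_rankOne.1 hT.1
  refine ⟨m, u, rfl, ?_⟩
  have := hT.2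
  rw [trace_sum_rankOne] at this
  exact_mod_cast this

lemma isCompact_densityOperators : IsCompact (densityOperators E) := by
  have : ProperSpace (E →L[ℂ] E) := FiniteDimensional.proper ℂ _
  refine Metric.isCompact_of_isClosed_isBounded ?_ ?_
  · have heq : densityOperators E =
        (⋂ x : E, {T : E →L[ℂ] E | 0 ≤ (inner ℂ (T x) x).re} ∩
          {T : E →L[ℂ] E | (inner ℂ (T x) x).im = 0}) ∩
          {T : E →L[ℂ] E | LinearMap.trace ℂ E (T : E →ₗ[ℂ] E) = 1} := by
      ext T
      simp only [densityOperators, Set.mem_inter_iff, Set.mem_iInter, Set.mem_ofPred_eq]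
      refine and_congr_left fun _ => ?_
      rw [ContinuousLinearMap.isPositive_iff_complex]
      exact forall_congr' fun x => ⟨fun h => ⟨h.2, (congrArg Complex.im h.1).symm⟩,
        fun h => ⟨Complex.ext rfl h.2.symm, h.1⟩⟩
    rw [heq]
    refine IsClosed.inter (isClosed_iInter fun x => IsClosed.inter
      (isClosed_le continuous_const ?_) (isClosed_eq ?_ continuous_const))
      (isClosed_eq ?_ continuous_const)
    · fun_prop
    · fun_prop
    · exact LinearMap.continuous_of_finiteDimensional
        ((LinearMap.trace ℂ E) ∘ₗ ContinuousLinearMap.coeLM ℂ)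
  · refine (Metric.isBounded_closedBall (x := (0 : E →L[ℂ] E)) (r := 1)).subset fun T hT => ?_
    obtain ⟨m, u, rfl, hu⟩ := exists_eq_sum_rankOne_of_mem_densityOperators hT
    rw [mem_closedBall_zero_iff, ← hu]
    refine (norm_sum_le _ _).trans (Finset.sum_le_sum fun i _ => ?_)
    rw [InnerProductSpace.norm_rankOne, sq]

end DensityOperators

section Functionals

variable {E : Type*} [NormedAddCommGroup E] [InnerProductSpace ℂ E]

lemma re_inner_rankOne_self (v w : E) :
    (inner ℂ (InnerProductSpace.rankOne ℂ w w v) v).re = ‖inner ℂ v w‖ ^ 2 := by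
  rw [InnerProductSpace.rankOne_apply, inner_smul_left, inner_conj_symm,
    ← inner_conj_symm w v, Complex.mul_conj, Complex.ofReal_re, Complex.normSq_eq_norm_sq]

variable [CompleteSpace E]

/-- The Riesz representation of the sesquilinear form `(v, w) ↦ φ |w⟩⟨v|`, on the diagonal. -/
lemma exists_forall_inner_eq_rankOne (φ : StrongDual ℂ (E →L[ℂ] E)) :
    ∃ B : E →L[ℂ] E, ∀ v, inner ℂ (B v) v = φ (InnerProductSpace.rankOne ℂ v v) := by
  refine ⟨InnerProductSpace.continuousLinearMapOfBilin
    (((ContinuousLinearMap.compL ℂ E (E →L[ℂ] E) ℂ) φ).comp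
      (InnerProductSpace.rankOne ℂ (E := E) (F := E)).flip), fun v => ?_⟩
  rw [InnerProductSpace.continuousLinearMapOfBilin_apply]
  rfl

/-- Every real linear functional on the operators of a Hilbert space is represented on the rank-one
operators `|v⟩⟨v|` by the quadratic form of a self-adjoint operator. -/
lemma exists_isSelfAdjoint_forall_rankOne (f : StrongDual ℝ (E →L[ℂ] E)) :
    ∃ A : E →L[ℂ] E, IsSelfAdjoint A ∧
      ∀ v, (inner ℂ (A v) v).re = f (InnerProductSpace.rankOne ℂ v v) := by
  obtain ⟨B, hB⟩ := exists_forall_inner_eq_rankOne (StrongDual.extendRCLike (𝕜 := ℂ) f)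
  have hBv : ∀ v, (inner ℂ (B v) v).re = f (InnerProductSpace.rankOne ℂ v v) := fun v => by
    rw [hB]
    exact StrongDual.re_extendRCLike_apply (𝕜 := ℂ) f (InnerProductSpace.rankOne ℂ v v)
  refine ⟨((2⁻¹ : ℝ) : ℂ) • (B + star B), ?_, fun v => ?_⟩
  · exact IsSelfAdjoint.smul (Complex.conj_ofReal _) (IsSelfAdjoint.add_star_self B)
  · have hs : (inner ℂ ((star B) v) v).re = (inner ℂ (B v) v).re := by
      rw [ContinuousLinearMap.star_eq_adjoint, ContinuousLinearMap.adjoint_inner_left,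
        ← inner_conj_symm, Complex.conj_re]
    rw [smul_apply, inner_smul_left, add_apply, inner_add_left, ← hBv,
      Complex.conj_ofReal, Complex.re_ofReal_mul, Complex.add_re, hs]
    ring

/-- Separation of a compact convex set `Q` of operator tuples from the closed cone of tuples with
nonnegative real quadratic form. The separating functional is given on the rank-one operators by
positive quadratic forms. -/
lemma exists_separating_forms {P : Type*} [Fintype P] [DecidableEq P] {H : P → Type*}
    [∀ p, NormedAddCommGroup (H p)] [∀ p, InnerProductSpace ℂ (H p)] [∀ p, CompleteSpace (H p)]
    {Q : Set (∀ p, H p →L[ℂ] H p)} (hQ : IsCompact Q) (hQc : Convex ℝ Q)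
    (hdisj : Disjoint Q {A | ∀ p v, 0 ≤ (inner ℂ (A p v) v).re}) :
    ∃ (f : StrongDual ℝ (∀ p, H p →L[ℂ] H p)) (δ : ℝ) (Δ : ∀ p, H p →L[ℂ] H p),
      0 < δ ∧ (∀ A ∈ Q, f A ≤ -δ) ∧ (∀ p, IsSelfAdjoint (Δ p)) ∧
      (∀ p v, 0 ≤ (inner ℂ (Δ p v) v).re) ∧
      ∀ p v, (inner ℂ (Δ p v) v).re = f (Pi.single p (InnerProductSpace.rankOne ℂ v v)) := by
  set C : Set (∀ p, H p →L[ℂ] H p) := {A | ∀ p v, 0 ≤ (inner ℂ (A p v) v).re} with hC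
  have hsmul : ∀ {A} (a : ℝ), 0 ≤ a → A ∈ C → a • A ∈ C := fun {A} a ha hA p v => by
    have : (inner ℂ ((a • A) p v) v).re = a * (inner ℂ (A p v) v).re := by
      rw [Pi.smul_apply, smul_apply, ← Complex.coe_smul, inner_smul_left, Complex.conj_ofReal,
        Complex.re_ofReal_mul]
    rw [this]
    exact mul_nonneg ha (hA p v)
  have hadd : ∀ {A B}, A ∈ C → B ∈ C → A + B ∈ C := fun {A B} hA hB p v => by
    rw [Pi.add_apply, add_apply, inner_add_left, Complex.add_re]
    exact add_nonneg (hA p v) (hB p v)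
  have hCconv : Convex ℝ C := fun A hA B hB a b ha hb _ => hadd (hsmul a ha hA) (hsmul b hb hB)
  have hCclosed : IsClosed C := by
    simp only [hC, Set.ofPred_forall]
    refine isClosed_iInter fun p => isClosed_iInter fun v => isClosed_le continuous_const ?_
    fun_prop
  obtain ⟨f, u, w, hu, huw, hw⟩ := geometric_hahn_banach_compact_closed hQc hQ hCconv hCclosed hdisj
  have hw0 : w < 0 := by simpa using hw 0 (fun p v => by simp)
  -- a functional bounded below on a cone is nonnegative there
  have hf : ∀ A ∈ C, 0 ≤ f A := by
    intro A hA
    by_contra! hneg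
    have := hw _ (hsmul (w / f A) (div_pos_of_neg_of_neg hw0 hneg).le hA)
    rw [map_smul, smul_eq_mul, div_mul_cancel₀ _ hneg.ne] at this
    exact lt_irrefl _ this
  choose Δ hΔsa hΔ using fun p => exists_isSelfAdjoint_forall_rankOne
    (f ∘L ContinuousLinearMap.single ℝ (fun p => H p →L[ℂ] H p) p)
  refine ⟨f, -u, Δ, by linarith, fun A hA => by linarith [hu A hA], hΔsa, fun p v => ?_, hΔ⟩
  rw [hΔ]
  refine hf _ fun q x => ?_
  change 0 ≤ (inner ℂ ((Pi.single p (InnerProductSpace.rankOne ℂ v v) :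
    ∀ p, H p →L[ℂ] H p) q x) x).re
  by_cases hq : q = p
  · subst hq
    rw [Pi.single_eq_same, re_inner_rankOne_self]
    positivity
  · simp [Pi.single_eq_of_ne hq]

end Functionals

namespace AdmissibleGraph

variable {V : Type*} {G : AdmissibleGraph V} [Finite V]
  {H : G.Comp → Type*} [∀ p, NormedAddCommGroup (H p)] [∀ p, InnerProductSpace ℂ (H p)]
  [∀ p, CompleteSpace (H p)]

/-- For an operator `T` on the source space, the operators
`∑ᵣ ι_r^* M T M^* ι_r - ∑ₛ ι_s^* T ι_s` on the spaces `H p`. -/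
noncomputable def blockBalance (M : G.SrcSpace H →L[ℂ] G.RngSpace H) :
    (G.SrcSpace H →L[ℂ] G.SrcSpace H) →ₗ[ℝ] ∀ p, H p →L[ℂ] H p where
  toFun T p := ∑ r : G.Rng p, (G.rngProj H r ∘L M) ∘L T ∘L
      ContinuousLinearMap.adjoint (G.rngProj H r ∘L M) -
    ∑ s : G.Src p, G.srcProj H s ∘L T ∘L ContinuousLinearMap.adjoint (G.srcProj H s)
  map_add' T S := by
    funext p
    simp only [ContinuousLinearMap.add_comp, ContinuousLinearMap.comp_add,
      Finset.sum_add_distrib, Pi.add_apply]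
    abel
  map_smul' c T := by
    funext p
    simp only [ContinuousLinearMap.smul_comp, ContinuousLinearMap.comp_smul,
      ← Finset.smul_sum, Pi.smul_apply, smul_sub, RingHom.id_apply]

lemma continuous_blockBalance (M : G.SrcSpace H →L[ℂ] G.RngSpace H) :
    Continuous (blockBalance M) := by
  refine continuous_pi fun p => Continuous.sub
    (continuous_finsetSum _ fun r _ => ?_) (continuous_finsetSum _ fun s _ => ?_)
  · exact continuous_const.clm_comp (continuous_id.clm_comp continuous_const)
  · exact continuous_const.clm_comp (continuous_id.clm_comp continuous_const)

lemma blockBalance_rankOne (M : G.SrcSpace H →L[ℂ] G.RngSpace H) (h : G.SrcSpace H) (p : G.Comp) :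
    blockBalance M (InnerProductSpace.rankOne ℂ h h) p =
      ∑ r : G.Rng p, InnerProductSpace.rankOne ℂ (M h ⟨p, r⟩) (M h ⟨p, r⟩) -
        ∑ s : G.Src p, InnerProductSpace.rankOne ℂ (h ⟨p, s⟩) (h ⟨p, s⟩) := by
  have key : ∀ (A : G.SrcSpace H →L[ℂ] H p), A ∘L InnerProductSpace.rankOne ℂ h h ∘L
      ContinuousLinearMap.adjoint A = InnerProductSpace.rankOne ℂ (A h) (A h) := fun A => by
    ext v
    simp [ContinuousLinearMap.adjoint_inner_right]
  simp only [blockBalance, LinearMap.coe_mk, AddHom.coe_mk, key]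
  rfl

/-- A solution of the matrix inequality with positive semidefinite blocks becomes one with strictly
positive blocks after adding a small multiple of the identity. -/
lemma exists_lmi_of_forms {M : G.SrcSpace H →L[ℂ] G.RngSpace H} {δ : ℝ}
    {Δ : ∀ p, H p →L[ℂ] H p} (hδ : 0 < δ) (hΔsa : ∀ p, IsSelfAdjoint (Δ p))
    (hΔ0 : ∀ p v, 0 ≤ (inner ℂ (Δ p v) v).re)
    (hform : ∀ h : G.SrcSpace H, δ * ‖h‖ ^ 2 ≤
      ∑ i, (inner ℂ (Δ i.1 (h i)) (h i)).re - ∑ i, (inner ℂ (Δ i.1 (M h i)) (M h i)).re) :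
    ∃ Γ : ∀ p, H p →L[ℂ] H p, (∀ p, IsStrictlyPositive (Γ p)) ∧
      IsStrictlyPositive (G.srcDiag Γ - ContinuousLinearMap.adjoint M ∘L G.rngDiag Γ ∘L M) := by
  -- the perturbation costs at most `ε ‖M‖² ‖h‖²`, which this choice makes at most half of `δ ‖h‖²`
  set ε : ℝ := δ / (2 * (‖M‖ ^ 2 + 1)) with hε
  have hden : 0 < 2 * (‖M‖ ^ 2 + 1) := by positivity
  have hε0 : 0 < ε := div_pos hδ hden
  set Γ : ∀ p, H p →L[ℂ] H p := fun p => Δ p + (ε : ℂ) • ContinuousLinearMap.id ℂ (H p) with hΓ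
  have hΓsa : ∀ p, IsSelfAdjoint (Γ p) := fun p =>
    (hΔsa p).add (IsSelfAdjoint.smul (Complex.conj_ofReal ε) (IsSelfAdjoint.one _))
  have hΓq : ∀ p v, (inner ℂ (Γ p v) v).re = (inner ℂ (Δ p v) v).re + ε * ‖v‖ ^ 2 := by
    intro p v
    simp only [hΓ, add_apply, inner_add_left, smul_apply, ContinuousLinearMap.id_apply,
      inner_smul_left, Complex.conj_ofReal, Complex.add_re, Complex.re_ofReal_mul]
    congr 2
    exact inner_self_eq_norm_sq (𝕜 := ℂ) v
  refine ⟨Γ, fun p => isStrictlyPositive_of_forall_le (hΓsa p) hε0 fun v => ?_,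
    isStrictlyPositive_of_forall_le (ε := δ / 2) ?_ (by linarith) fun h => ?_⟩
  · rw [hΓq]; linarith [hΔ0 p v]
  · exact (isSelfAdjoint_srcDiag hΓsa).sub ((isSelfAdjoint_rngDiag hΓsa).adjoint_conj M)
  · have h1 : (inner ℂ ((G.srcDiag Γ - ContinuousLinearMap.adjoint M ∘L G.rngDiag Γ ∘L M) h)
        h).re = (∑ i, (inner ℂ (Δ i.1 (h i)) (h i)).re + ε * ‖h‖ ^ 2) -
          (∑ i, (inner ℂ (Δ i.1 (M h i)) (M h i)).re + ε * ‖M h‖ ^ 2) := by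
      rw [sub_apply, inner_sub_left, ContinuousLinearMap.comp_apply,
        ContinuousLinearMap.comp_apply, ContinuousLinearMap.adjoint_inner_left]
      simp only [PiLp.inner_apply, Complex.sub_re, Complex.re_sum, srcDiag_apply, rngDiag_apply,
        hΓq, PiLp.norm_sq_eq_of_L2, Finset.sum_add_distrib, Finset.mul_sum]
    rw [h1]
    have h2 : ‖M h‖ ^ 2 ≤ ‖M‖ ^ 2 * ‖h‖ ^ 2 := by
      rw [← mul_pow]; exact pow_le_pow_left₀ (norm_nonneg _) (M.le_opNorm h) 2
    have h3 : ε * (‖M‖ ^ 2 + 1) = δ / 2 := by rw [hε]; field_simp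
    have h4 : ε * ‖M‖ ^ 2 * ‖h‖ ^ 2 ≤ δ / 2 * ‖h‖ ^ 2 :=
      mul_le_mul_of_nonneg_right (by linarith) (sq_nonneg _)
    nlinarith [hform h, mul_le_mul_of_nonneg_left h2 hε0.le,
      mul_nonneg hε0.le (sq_nonneg ‖h‖)]

variable [∀ p, FiniteDimensional ℂ (H p)]

/-- If no block balance of a density operator has nonnegative real quadratic forms, then the
separating functional solves the matrix inequality in the semidefinite sense for `Γ`, and strictly
for the difference. -/
lemma exists_forms_of_disjoint (M : G.SrcSpace H →L[ℂ] G.RngSpace H)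
    (hdisj : Disjoint (blockBalance M '' densityOperators (G.SrcSpace H))
      {A | ∀ (p : G.Comp) (v : H p), 0 ≤ (inner ℂ (A p v) v).re}) :
    ∃ (δ : ℝ) (Δ : ∀ p, H p →L[ℂ] H p), 0 < δ ∧ (∀ p, IsSelfAdjoint (Δ p)) ∧
      (∀ p v, 0 ≤ (inner ℂ (Δ p v) v).re) ∧
      ∀ h : G.SrcSpace H, δ * ‖h‖ ^ 2 ≤
        ∑ i, (inner ℂ (Δ i.1 (h i)) (h i)).re - ∑ i, (inner ℂ (Δ i.1 (M h i)) (M h i)).re := by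
  classical
  obtain ⟨f, δ, Δ, hδ, hfQ, hΔsa, hΔ0, hΔ⟩ := exists_separating_forms
    (isCompact_densityOperators.image (continuous_blockBalance M))
    (convex_densityOperators.linear_image _) hdisj
  refine ⟨δ, Δ, hδ, hΔsa, hΔ0, fun h => ?_⟩
  have hunit : ∀ h : G.SrcSpace H, ‖h‖ = 1 →
      δ ≤ ∑ i, (inner ℂ (Δ i.1 (h i)) (h i)).re -
        ∑ i, (inner ℂ (Δ i.1 (M h i)) (M h i)).re := by
    intro h hh
    have h1 := hfQ _ (Set.mem_image_of_mem _ (rankOne_self_mem_densityOperators hh))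
    have h2 : blockBalance M (InnerProductSpace.rankOne ℂ h h) =
        ∑ p, Pi.single p (blockBalance M (InnerProductSpace.rankOne ℂ h h) p) :=
      (Finset.univ_sum_single _).symm
    rw [h2, map_sum] at h1
    have h3 : ∀ p, f (Pi.single p (blockBalance M (InnerProductSpace.rankOne ℂ h h) p)) =
        ∑ r : G.Rng p, (inner ℂ (Δ p (M h ⟨p, r⟩)) (M h ⟨p, r⟩)).re -
          ∑ s : G.Src p, (inner ℂ (Δ p (h ⟨p, s⟩)) (h ⟨p, s⟩)).re := by
      intro p
      change (f ∘L ContinuousLinearMap.single ℝ (fun p => H p →L[ℂ] H p) p) _ = _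
      rw [blockBalance_rankOne, map_sub, map_sum, map_sum]
      simp only [hΔ]
      rfl
    simp only [h3, Finset.sum_sub_distrib] at h1
    rw [Fintype.sum_sigma, Fintype.sum_sigma]
    linarith
  by_cases h0 : h = 0
  · simp [h0]
  · have hn : 0 < ‖h‖ := norm_pos_iff.2 h0
    have h1 := hunit (((‖h‖⁻¹ : ℝ) : ℂ) • h) (by
      rw [norm_smul, Complex.norm_real, norm_inv, norm_norm, inv_mul_cancel₀ hn.ne'])
    simp only [map_smul, PiLp.smul_apply, inner_smul_left, inner_smul_right,
      Complex.conj_ofReal, Complex.re_ofReal_mul, ← Finset.mul_sum, ← mul_sub] at h1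
    have h2 := mul_le_mul_of_nonneg_right h1 (sq_nonneg ‖h‖)
    refine h2.trans_eq ?_
    field_simp

/-- The alternative to solvability of the matrix inequality: if no `Γ` solves it, then there is a
finite family of vectors `g i`, not all zero, with
`∑ₛ ∑ᵢ |g i s⟩⟨g i s| ≤ ∑ᵣ ∑ᵢ |(M g i) r⟩⟨(M g i) r|` on each `H p`. -/
theorem exists_lmi_or_exists_family (M : G.SrcSpace H →L[ℂ] G.RngSpace H) :
    (∃ Γ : ∀ p, H p →L[ℂ] H p, (∀ p, IsStrictlyPositive (Γ p)) ∧
      IsStrictlyPositive (G.srcDiag Γ - ContinuousLinearMap.adjoint M ∘L G.rngDiag Γ ∘L M)) ∨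
    ∃ (m : ℕ) (g : Fin m → G.SrcSpace H), ∑ i, ‖g i‖ ^ 2 = 1 ∧
      ∀ (p : G.Comp) (v : H p),
        ∑ s : G.Src p, ∑ i, ‖inner ℂ v (g i ⟨p, s⟩)‖ ^ 2 ≤
          ∑ r : G.Rng p, ∑ i, ‖inner ℂ v (M (g i) ⟨p, r⟩)‖ ^ 2 := by
  by_cases hdisj : Disjoint (blockBalance M '' densityOperators (G.SrcSpace H))
      {A | ∀ (p : G.Comp) (v : H p), 0 ≤ (inner ℂ (A p v) v).re}
  · obtain ⟨δ, Δ, hδ, hsa, h0, hform⟩ := exists_forms_of_disjoint M hdisj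
    exact Or.inl (exists_lmi_of_forms hδ hsa h0 hform)
  · right
    rw [Set.not_disjoint_iff] at hdisj
    obtain ⟨_, ⟨T, hT, rfl⟩, hTC⟩ := hdisj
    obtain ⟨m, g, rfl, hg⟩ := exists_eq_sum_rankOne_of_mem_densityOperators hT
    refine ⟨m, g, hg, fun p v => ?_⟩
    have h1 := hTC p v
    rw [map_sum, Finset.sum_apply] at h1
    simp only [blockBalance_rankOne, Finset.sum_sub_distrib, sub_apply, _root_.sum_apply,
      inner_sub_left, sum_inner, Complex.sub_re, Complex.re_sum, re_inner_rankOne_self] at h1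
    rw [Finset.sum_comm, Finset.sum_comm (s := (Finset.univ : Finset (G.Rng p)))]
    linarith

end AdmissibleGraph

/-! ### Contractions in the enhanced uncertainty set -/

/-- **Douglas' lemma**, for operators with finite-dimensional domain: if `‖b x‖ ≤ ‖a x‖` for all
`x`, then `b` factors through `a` by a contraction. -/
lemma exists_contraction_comp_eq {X E F : Type*} [AddCommGroup X] [Module ℂ X]
    [FiniteDimensional ℂ X] [NormedAddCommGroup E] [InnerProductSpace ℂ E]
    [NormedAddCommGroup F] [InnerProductSpace ℂ F] (a : X →ₗ[ℂ] E) (b : X →ₗ[ℂ] F)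
    (h : ∀ x, ‖b x‖ ≤ ‖a x‖) : ∃ W : E →L[ℂ] F, ‖W‖ ≤ 1 ∧ ∀ x, W (a x) = b x := by
  have hker : LinearMap.ker a ≤ LinearMap.ker b := fun x hx => by
    rw [LinearMap.mem_ker] at hx ⊢
    simpa [hx] using h x
  set U : LinearMap.range a →ₗ[ℂ] F :=
    (LinearMap.ker a).liftQ b hker ∘ₗ a.quotKerEquivRange.symm.toLinearMap with hU
  have hUa : ∀ x, U (a.rangeRestrict x) = b x := fun x => by
    have : a.quotKerEquivRange.symm (a.rangeRestrict x) = (LinearMap.ker a).mkQ x := by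
      rw [LinearEquiv.symm_apply_eq]
      rfl
    rw [hU, LinearMap.comp_apply, LinearEquiv.coe_coe, this]
    rfl
  have hUle : ∀ y, ‖U y‖ ≤ 1 * ‖y‖ := by
    intro y
    obtain ⟨x, rfl⟩ := a.surjective_rangeRestrict y
    rw [hUa, one_mul]
    exact h x
  refine ⟨U.mkContinuous 1 hUle ∘L (LinearMap.range a).orthogonalProjectionOnto, ?_, fun x => ?_⟩
  · refine (ContinuousLinearMap.opNorm_comp_le _ _).trans ?_
    exact mul_le_one₀ (U.mkContinuous_norm_le zero_le_one hUle) (norm_nonneg _)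
      (LinearMap.range a).orthogonalProjectionOnto_norm_le
  · have : (LinearMap.range a).orthogonalProjectionOnto (a x) = a.rangeRestrict x :=
      (LinearMap.range a).orthogonalProjectionOnto_mem_subspace_eq_self (a.rangeRestrict x)
    rw [ContinuousLinearMap.comp_apply, this]
    exact hUa x

/-- A block operator `W : ⨁_b K → ⨁_a K` amplified by a finite-dimensional space does not increase
in norm. -/
lemma sum_norm_sq_mapL_le {K : Type*} [NormedAddCommGroup K] [InnerProductSpace ℂ K]
    {H : Type*} [NormedAddCommGroup H] [InnerProductSpace ℂ H] [FiniteDimensional ℂ H]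
    {α β : Type*} [Fintype α] [Fintype β] {W : α → β → (K →L[ℂ] K)}
    (hW : ∀ k : β → K, ∑ a, ‖∑ b, W a b (k b)‖ ^ 2 ≤ ∑ b, ‖k b‖ ^ 2) (z : β → K ⊗[ℂ] H) :
    ∑ a, ‖∑ b, TensorProduct.mapL (W a b) (ContinuousLinearMap.id ℂ H) (z b)‖ ^ 2 ≤
      ∑ b, ‖z b‖ ^ 2 := by
  set e := tensorCoord K (stdOrthonormalBasis ℂ H) with he
  have hnorm : ∀ w : K ⊗[ℂ] H, ‖w‖ ^ 2 = ∑ j, ‖e w j‖ ^ 2 := fun w => by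
    rw [← e.norm_map w, PiLp.norm_sq_eq_of_L2]
  simp only [hnorm]
  rw [Finset.sum_comm, Finset.sum_comm (s := (Finset.univ : Finset β))]
  refine Finset.sum_le_sum fun j _ => ?_
  refine le_trans (le_of_eq ?_) (hW fun b => e (z b) j)
  refine Finset.sum_congr rfl fun a _ => ?_
  rw [map_sum, WithLp.ofLp_sum, Finset.sum_apply]
  simp only [he, tensorCoord_mapL]

section Slices

variable {K : Type*} [NormedAddCommGroup K] [InnerProductSpace ℂ K]

lemma Orthonormal.norm_sum_smul_sq {m : ℕ} {e : Fin m → K} (he : Orthonormal ℂ e)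
    (c : Fin m → ℂ) : ‖∑ i, c i • e i‖ ^ 2 = ∑ i, ‖c i‖ ^ 2 := by
  have h := he.inner_sum c c Finset.univ
  rw [inner_self_eq_norm_sq_to_K] at h
  have h2 : ((‖∑ i, c i • e i‖ ^ 2 : ℝ) : ℂ) = ((∑ i, ‖c i‖ ^ 2 : ℝ) : ℂ) := by
    push_cast
    refine h.trans (Finset.sum_congr rfl fun i _ => ?_)
    rw [mul_comm, Complex.mul_conj, Complex.normSq_eq_norm_sq, Complex.ofReal_pow]
  exact_mod_cast h2

lemma exists_orthonormal_of_infinite_dimensional (hK : ¬ FiniteDimensional ℂ K) (m : ℕ) :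
    ∃ e : Fin m → K, Orthonormal ℂ e := by
  have b := Module.Basis.ofVectorSpace ℂ K
  have hinf : Infinite (Module.Basis.ofVectorSpaceIndex ℂ K) := by
    by_contra h
    rw [not_infinite_iff_finite] at h
    exact hK (Module.Finite.of_basis b)
  have φ : Fin m ↪ Module.Basis.ofVectorSpaceIndex ℂ K :=
    Fin.valEmbedding.trans (Infinite.natEmbedding _)
  exact ⟨_, InnerProductSpace.gramSchmidtNormed_orthonormal
    (b.linearIndependent.comp φ φ.injective)⟩

variable {H : Type*} [NormedAddCommGroup H] [InnerProductSpace ℂ H]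
  {α β : Type*} {m : ℕ}

/-- The vectors `∑ᵢ eᵢ ⊗ g i c` of `K ⊗ H`, for `c : α`, as one operator from the dual of `H` to the
direct sum of copies of `K` indexed by `α`. The domain is the dual, because a map on `H` itself
would be conjugate-linear. -/
noncomputable def sliceMap (e : Fin m → K) (g : Fin m → α → H) :
    (H →L[ℂ] ℂ) →ₗ[ℂ] PiLp 2 (fun _ : α => K) where
  toFun φ := WithLp.toLp 2 fun c => ∑ i, φ (g i c) • e i
  map_add' φ ψ := by
    ext c
    simp [add_smul, Finset.sum_add_distrib]
  map_smul' t φ := by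
    ext c
    simp [mul_smul, Finset.smul_sum]

lemma sliceMap_apply (e : Fin m → K) (g : Fin m → α → H) (φ : H →L[ℂ] ℂ) (c : α) :
    sliceMap e g φ c = ∑ i, φ (g i c) • e i := rfl

lemma sum_tmul_eq_sum_basis {n : Type*} [Fintype n] (b : OrthonormalBasis n ℂ H) (e : Fin m → K)
    (f : Fin m → H) :
    ∑ i, e i ⊗ₜ[ℂ] f i = ∑ j, (∑ i, innerSL ℂ (b j) (f i) • e i) ⊗ₜ[ℂ] b j := by
  simp only [TensorProduct.sum_tmul]
  rw [Finset.sum_comm]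
  refine Finset.sum_congr rfl fun i _ => ?_
  conv_lhs => rw [← b.sum_repr' (f i)]
  rw [TensorProduct.tmul_sum]
  exact Finset.sum_congr rfl fun j _ => by rw [TensorProduct.smul_tmul]; rfl

variable [Fintype α] [Fintype β] [FiniteDimensional ℂ H]

/-- Douglas' lemma turns the domination `∑ₐ ∑ᵢ |g i a⟩⟨g i a| ≤ ∑_b ∑ᵢ |h i b⟩⟨h i b|` into a
contraction `W` on copies of `K` that carries `∑ᵢ eᵢ ⊗ h i` to `∑ᵢ eᵢ ⊗ g i`, for an orthonormal
family `e` of `K`. -/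
lemma exists_contraction_of_domination {e : Fin m → K}
    (he : Orthonormal ℂ e) {g : Fin m → α → H} {h : Fin m → β → H}
    (hdom : ∀ v : H, ∑ a, ∑ i, ‖inner ℂ v (g i a)‖ ^ 2 ≤ ∑ b, ∑ i, ‖inner ℂ v (h i b)‖ ^ 2) :
    ∃ W : α → β → (K →L[ℂ] K),
      (∀ k : β → K, ∑ a, ‖∑ b, W a b (k b)‖ ^ 2 ≤ ∑ b, ‖k b‖ ^ 2) ∧
      ∀ a, ∑ b, TensorProduct.mapL (W a b) (ContinuousLinearMap.id ℂ H) (∑ i, e i ⊗ₜ h i b) =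
        ∑ i, e i ⊗ₜ g i a := by
  classical
  have := FiniteDimensional.complete ℂ H
  have hle : ∀ φ : H →L[ℂ] ℂ, ‖sliceMap e g φ‖ ≤ ‖sliceMap e h φ‖ := fun φ => by
    obtain ⟨v, rfl⟩ := (InnerProductSpace.toDual ℂ H).surjective φ
    refine le_of_sq_le_sq ?_ (norm_nonneg _)
    rw [PiLp.norm_sq_eq_of_L2, PiLp.norm_sq_eq_of_L2]
    simp only [sliceMap_apply, he.norm_sum_smul_sq, InnerProductSpace.toDual_apply_apply]
    exact hdom v
  obtain ⟨W, hW1, hW⟩ := exists_contraction_comp_eq (sliceMap e h) (sliceMap e g) hle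
  have hsum : ∀ (k : PiLp 2 fun _ : β => K) (a : α),
      W k a = ∑ b, W (PiLp.single 2 b (k b)) a := fun k a => by
    have hk : k = ∑ b, PiLp.single 2 b (k b) := by
      ext c
      simp [Finset.sum_apply, Pi.single_apply]
    conv_lhs => rw [hk]
    rw [map_sum, WithLp.ofLp_sum, Finset.sum_apply]
  set w : α → β → (K →L[ℂ] K) := fun a b =>
    (PiLp.proj 2 (fun _ : α => K) a : _ →L[ℂ] K) ∘L W ∘L
      (PiLp.continuousLinearEquiv 2 ℂ (fun _ : β => K)).symm.toContinuousLinearMap ∘L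
        ContinuousLinearMap.single ℂ (fun _ : β => K) b with hw
  have hwW : ∀ a b k, w a b k = W (PiLp.single 2 b k) a := fun a b k => rfl
  refine ⟨w, fun k => ?_, fun a => ?_⟩
  · have h1 : ‖W (WithLp.toLp 2 k)‖ ≤ ‖WithLp.toLp 2 k‖ :=
      (W.le_of_opNorm_le hW1 _).trans_eq (one_mul _)
    have h2 := pow_le_pow_left₀ (norm_nonneg _) h1 2
    rw [PiLp.norm_sq_eq_of_L2, PiLp.norm_sq_eq_of_L2] at h2
    simpa only [hwW, hsum (WithLp.toLp 2 k)] using h2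
  · set b := stdOrthonormalBasis ℂ H
    rw [sum_tmul_eq_sum_basis b e fun i => g i a]
    simp only [sum_tmul_eq_sum_basis b e fun i => h i _, map_sum]
    rw [Finset.sum_comm]
    refine Finset.sum_congr rfl fun j _ => ?_
    simp only [TensorProduct.mapL_tmul, ContinuousLinearMap.id_apply]
    rw [← TensorProduct.sum_tmul]
    congr 1
    have h1 := hsum (sliceMap e h (innerSL ℂ (b j))) a
    rw [hW] at h1
    exact h1.symm

end Slices

namespace AdmissibleGraph

variable {V : Type*} {G : AdmissibleGraph V} [Finite V]
  {H : G.Comp → Type*} [∀ p, NormedAddCommGroup (H p)] [∀ p, InnerProductSpace ℂ (H p)]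
  [∀ p, FiniteDimensional ℂ (H p)]
  {K : Type*} [NormedAddCommGroup K] [InnerProductSpace ℂ K]

/-- A family of contractions `W p : ⨁_r K → ⨁_s K`, one for each component, assembles to a
contraction in the enhanced uncertainty set. -/
lemma norm_pencil_mapL_le {W : ∀ p, G.Src p → G.Rng p → (K →L[ℂ] K)}
    (hW : ∀ p (k : G.Rng p → K), ∑ s, ‖∑ r, W p s r (k r)‖ ^ 2 ≤ ∑ r, ‖k r‖ ^ 2)
    {Z : ∀ p, G.Edge p → (K ⊗[ℂ] H p →L[ℂ] K ⊗[ℂ] H p)}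
    (hZ : ∀ p s r, Z p (edgeOf s r) =
      TensorProduct.mapL (W p s r) (ContinuousLinearMap.id ℂ (H p))) :
    ‖G.pencil Z‖ ≤ 1 := by
  refine ContinuousLinearMap.opNorm_le_bound _ zero_le_one fun z => ?_
  rw [one_mul]
  refine le_of_sq_le_sq ?_ (norm_nonneg z)
  rw [PiLp.norm_sq_eq_of_L2, PiLp.norm_sq_eq_of_L2, Fintype.sum_sigma, Fintype.sum_sigma]
  refine Finset.sum_le_sum fun p _ => ?_
  simp only [pencil_apply, hZ]
  have key := sum_norm_sq_mapL_le (H := H p) (W := W p) (hW p) fun r => z ⟨p, r⟩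
  exact key

/-- A family of vectors violating the matrix inequality yields a contraction `D` in the enhanced
uncertainty set for which `(I ⊗ M) D` has the eigenvalue `1`. -/
theorem exists_enhanced_of_family (hK : ¬ FiniteDimensional ℂ K)
    {M : G.SrcSpace H →L[ℂ] G.RngSpace H} {m : ℕ} {g : Fin m → G.SrcSpace H}
    (hg : ∑ i, ‖g i‖ ^ 2 = 1)
    (hdom : ∀ (p : G.Comp) (v : H p),
      ∑ s : G.Src p, ∑ i, ‖inner ℂ v (g i ⟨p, s⟩)‖ ^ 2 ≤
        ∑ r : G.Rng p, ∑ i, ‖inner ℂ v (M (g i) ⟨p, r⟩)‖ ^ 2) :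
    ∃ D ∈ G.enhancedUncertainty H K, ‖D‖ ≤ 1 ∧ (1 : ℂ) ∈ spectrum ℂ (G.idTensor K M ∘L D) := by
  obtain ⟨e, he⟩ := exists_orthonormal_of_infinite_dimensional hK m
  choose W hW hWg using fun p => exists_contraction_of_domination (K := K) (H := H p)
    (α := G.Src p) (β := G.Rng p) he (g := fun i (s : G.Src p) => g i ⟨p, s⟩)
    (h := fun i (r : G.Rng p) => M (g i) ⟨p, r⟩) (hdom p)
  set Z : ∀ p, G.Edge p → (K ⊗[ℂ] H p →L[ℂ] K ⊗[ℂ] H p) := fun p a =>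
    TensorProduct.mapL (W p a.src a.rng) (ContinuousLinearMap.id ℂ (H p)) with hZ
  set x : G.SrcSpace (fun p => K ⊗[ℂ] H p) := tensorPiLp K _ (∑ i, e i ⊗ₜ g i) with hx
  set y : G.RngSpace (fun p => K ⊗[ℂ] H p) := tensorPiLp K _ (∑ i, e i ⊗ₜ M (g i)) with hy
  have hMx : G.idTensor K M x = y := by
    rw [idTensor_eq_ampliation, ampliation, hx, conjTensorPiLp_apply, map_sum]
    rfl
  have hDy : G.pencil Z y = x := PiLp.ext fun i => by
    have := hWg i.1 i.2
    rw [pencil_apply]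
    simp only [hy, hx, map_sum, WithLp.ofLp_sum, Finset.sum_apply, tensorPiLp_tmul] at this ⊢
    exact this
  have hx0 : x ≠ 0 := by
    intro h0
    have h1 : ∑ i, e i ⊗ₜ[ℂ] g i = 0 :=
      (tensorPiLp K fun i : (p : G.Comp) × G.Src p => H i.1).map_eq_zero_iff.1 h0
    have h2 : inner ℂ (∑ i, e i ⊗ₜ[ℂ] g i) (∑ i, e i ⊗ₜ[ℂ] g i) = (1 : ℂ) := by
      simp only [sum_inner, inner_sum, TensorProduct.inner_tmul, orthonormal_iff_ite.1 he,
        ite_mul, one_mul, zero_mul, Finset.sum_ite_eq', Finset.mem_univ,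
        if_true, inner_self_eq_norm_sq_to_K]
      simpa using congrArg Complex.ofReal hg
    rw [h1, inner_zero_left] at h2
    exact zero_ne_one h2
  refine ⟨G.pencil Z, ⟨Z, fun p a => ⟨_, rfl⟩, rfl⟩,
    norm_pencil_mapL_le (W := W) hW fun p s r => rfl, ?_⟩
  rw [spectrum.mem_iff]
  intro hunit
  obtain ⟨u, hu⟩ := hunit
  have huy : u.val y = 0 := by
    rw [hu, sub_apply, ContinuousLinearMap.comp_apply, hDy, hMx]
    simp
  have hy0 : y = 0 := by
    have : (u⁻¹).val (u.val y) = y := by rw [← mul_apply_eq_comp, Units.inv_mul]; rfl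
    rw [← this, huy, map_zero]
  exact hx0 (by rw [← hDy, hy0, map_zero])

end AdmissibleGraph

/-! ### Homogeneity and the equality -/

section Scaling

variable {E F : Type*} [NormedAddCommGroup E] [NormedSpace ℂ E]
  [NormedAddCommGroup F] [NormedSpace ℂ F]

lemma scalingBound_eq_smul (𝓓 : Set (E →L[ℂ] F)) (M : F →L[ℂ] E) {t : ℂ} (ht : t ≠ 0) :
    scalingBound 𝓓 M = ‖t‖ₑ * scalingBound 𝓓 (t⁻¹ • M) := by
  have h0 : ‖t‖ₑ ≠ 0 := by simpa using ht
  have h1 : ‖t‖ₑ ≠ ⊤ := by simp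
  simp only [scalingBound, ENNReal.mul_iInf_of_ne h0 h1]
  refine iInf_congr fun X => iInf_congr fun Y => iInf_congr fun _ => ?_
  rw [ContinuousLinearMap.smul_comp, ContinuousLinearMap.comp_smul, ← enorm_smul,
    smul_inv_smul₀ ht]

end Scaling

namespace AdmissibleGraph

variable {V : Type*} {G : AdmissibleGraph V} [Finite V]
  {H : G.Comp → Type*} [∀ p, NormedAddCommGroup (H p)] [∀ p, InnerProductSpace ℂ (H p)]
  {K : Type*} [NormedAddCommGroup K] [InnerProductSpace ℂ K]

lemma idTensor_smul (c : ℂ) (M : G.SrcSpace H →L[ℂ] G.RngSpace H) :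
    G.idTensor K (c • M) = c • G.idTensor K M := by
  rw [idTensor_eq_ampliation, idTensor_eq_ampliation, ampliation, ampliation,
    ContinuousLinearMap.lTensor_smul]
  simp [conjTensorPiLp]

lemma pencil_smul (c : ℂ) (Z : ∀ p, G.Edge p → (H p →L[ℂ] H p)) :
    G.pencil (fun p e => c • Z p e) = c • G.pencil Z := by
  refine ContinuousLinearMap.ext fun x => PiLp.ext fun i => ?_
  rw [pencil_apply, smul_apply, PiLp.smul_apply, pencil_apply, Finset.smul_sum]
  rfl

lemma smul_mem_enhancedUncertainty (c : ℂ)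
    {D : G.RngSpace (fun p => K ⊗[ℂ] H p) →L[ℂ] G.SrcSpace (fun p => K ⊗[ℂ] H p)}
    (hD : D ∈ G.enhancedUncertainty H K) : c • D ∈ G.enhancedUncertainty H K := by
  obtain ⟨Z, hZ, rfl⟩ := hD
  refine ⟨fun p e => c • Z p e, fun p e => ?_, ?_⟩
  · obtain ⟨W, hW⟩ := hZ p e
    refine ⟨c • W, ?_⟩
    change TensorProduct.mapL (c • W) _ = c • Z p e
    rw [← hW]
    exact TensorProduct.mapL_smul_left c W _
  · exact (pencil_smul c Z).symm

variable [∀ p, CompleteSpace (H p)] [∀ p, FiniteDimensional ℂ (H p)]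

/-- If the structured singular value is less than `t`, then the matrix inequality for `t⁻¹ M` is
solvable, since the alternative provides a perturbation of norm at most `t⁻¹`. -/
theorem exists_lmi_of_structuredSingularValue_lt (hK : ¬ FiniteDimensional ℂ K)
    (M : G.SrcSpace H →L[ℂ] G.RngSpace H) {t : ℝ} (ht : 0 < t)
    (h : structuredSingularValue (G.enhancedUncertainty H K) (G.idTensor K M) <
      ENNReal.ofReal t) :
    ∃ Γ : ∀ p, H p →L[ℂ] H p, (∀ p, IsStrictlyPositive (Γ p)) ∧
      IsStrictlyPositive (G.srcDiag Γ - ContinuousLinearMap.adjoint ((t : ℂ)⁻¹ • M) ∘L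
        G.rngDiag Γ ∘L ((t : ℂ)⁻¹ • M)) := by
  refine (exists_lmi_or_exists_family ((t : ℂ)⁻¹ • M)).resolve_right ?_
  rintro ⟨m, g, hg, hdom⟩
  obtain ⟨D, hD, hD1, hspec⟩ := exists_enhanced_of_family (K := K) hK hg hdom
  refine h.not_ge ?_
  rw [structuredSingularValue, ENNReal.le_inv_iff_le_inv]
  have hmem : (t : ℂ)⁻¹ • D ∈ {D | D ∈ G.enhancedUncertainty H K ∧
      (1 : ℂ) ∈ spectrum ℂ (G.idTensor K M ∘L D)} := by
    refine ⟨smul_mem_enhancedUncertainty _ hD, ?_⟩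
    rw [ContinuousLinearMap.comp_smul, ← ContinuousLinearMap.smul_comp, ← idTensor_smul]
    exact hspec
  refine (iInf₂_le _ hmem).trans ?_
  rw [← ENNReal.ofReal_inv_of_pos ht, ← ofReal_norm, norm_smul, norm_inv, Complex.norm_real,
    Real.norm_of_nonneg ht.le]
  exact ENNReal.ofReal_le_ofReal (mul_le_of_le_one_right (inv_nonneg.2 ht.le) hD1)

lemma scalingBound_lt_one_of_lmi {M : G.SrcSpace H →L[ℂ] G.RngSpace H}
    {Γ : ∀ p, H p →L[ℂ] H p} (hΓ : ∀ p, IsStrictlyPositive (Γ p))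
    (hM : IsStrictlyPositive
      (G.srcDiag Γ - ContinuousLinearMap.adjoint M ∘L G.rngDiag Γ ∘L M)) :
    scalingBound (G.classicalUncertainty H) M < 1 :=
  scalingBound_lt_one (diag_mem_intertwiners Γ) (isStrictlyPositive_rngDiag hΓ)
    (isStrictlyPositive_srcDiag hΓ) hM

/-- By homogeneity, every `t > μ(I ⊗ M)` bounds `μ̂(M)`: the matrix inequality for `t⁻¹ M` is
solvable, so `μ̂(t⁻¹ M) < 1`. -/
theorem scalingBound_le_structuredSingularValue (hK : ¬ FiniteDimensional ℂ K)
    (M : G.SrcSpace H →L[ℂ] G.RngSpace H) :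
    scalingBound (G.classicalUncertainty H) M ≤
      structuredSingularValue (G.enhancedUncertainty H K) (G.idTensor K M) := by
  refine le_of_forall_gt_imp_ge_of_dense fun c hc => ?_
  rcases eq_or_ne c ⊤ with rfl | hctop
  · exact le_top
  · have ht : 0 < c.toReal := ENNReal.toReal_pos (pos_of_gt hc).ne' hctop
    have ht0 : (c.toReal : ℂ) ≠ 0 := by exact_mod_cast ht.ne'
    obtain ⟨Γ, hΓ, hM⟩ := exists_lmi_of_structuredSingularValue_lt hK M ht
      (by rwa [ENNReal.ofReal_toReal hctop])
    rw [scalingBound_eq_smul _ M ht0, ← ofReal_norm, Complex.norm_real,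
      Real.norm_of_nonneg ht.le, ENNReal.ofReal_toReal hctop]
    exact mul_le_of_le_one_right' (scalingBound_lt_one_of_lmi hΓ hM).le

end AdmissibleGraph

theorem theorem3p1 {V : Type*} [Finite V] (G : AdmissibleGraph V)
    (H : G.Comp → Type*) [∀ p, NormedAddCommGroup (H p)] [∀ p, InnerProductSpace ℂ (H p)]
    [∀ p, CompleteSpace (H p)] [∀ p, FiniteDimensional ℂ (H p)]
    (K : Type*) [NormedAddCommGroup K] [InnerProductSpace ℂ K] [CompleteSpace K]
    [TopologicalSpace.SeparableSpace K] (hK : ¬ FiniteDimensional ℂ K)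
    (M : G.SrcSpace H →L[ℂ] G.RngSpace H) :
    structuredSingularValue (G.enhancedUncertainty H K) (G.idTensor K M) =
        scalingBound (G.classicalUncertainty H) M ∧
      (structuredSingularValue (G.enhancedUncertainty H K) (G.idTensor K M) < 1 ↔
        scalingBound (G.classicalUncertainty H) M < 1) ∧
      (structuredSingularValue (G.enhancedUncertainty H K) (G.idTensor K M) < 1 ↔
        ∃ XY ∈ intertwiners (G.classicalUncertainty H),
          IsStrictlyPositive XY.1 ∧ IsStrictlyPositive XY.2 ∧
            IsStrictlyPositive (XY.2 - ContinuousLinearMap.adjoint M ∘L XY.1 ∘L M)) ∧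
      (structuredSingularValue (G.enhancedUncertainty H K) (G.idTensor K M) < 1 ↔
        ∃ Γ : ∀ p, H p →L[ℂ] H p, (∀ p, IsStrictlyPositive (Γ p)) ∧
          IsStrictlyPositive
            (G.srcDiag Γ - ContinuousLinearMap.adjoint M ∘L G.rngDiag Γ ∘L M)) := by
  have heq : structuredSingularValue (G.enhancedUncertainty H K) (G.idTensor K M) =
      scalingBound (G.classicalUncertainty H) M :=
    le_antisymm (AdmissibleGraph.structuredSingularValue_le_scalingBound M)
      (AdmissibleGraph.scalingBound_le_structuredSingularValue hK M)
  have hlmi : structuredSingularValue (G.enhancedUncertainty H K) (G.idTensor K M) < 1 →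
      ∃ Γ : ∀ p, H p →L[ℂ] H p, (∀ p, IsStrictlyPositive (Γ p)) ∧
        IsStrictlyPositive
          (G.srcDiag Γ - ContinuousLinearMap.adjoint M ∘L G.rngDiag Γ ∘L M) := fun h => by
    have := AdmissibleGraph.exists_lmi_of_structuredSingularValue_lt hK M one_pos
      (by rwa [ENNReal.ofReal_one])
    simpa using this
  refine ⟨heq, by rw [heq], ⟨fun h => ?_, ?_⟩, ⟨hlmi, ?_⟩⟩
  · obtain ⟨Γ, hΓ, hM⟩ := hlmi h
    exact ⟨_, AdmissibleGraph.diag_mem_intertwiners Γ,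
      AdmissibleGraph.isStrictlyPositive_rngDiag hΓ,
      AdmissibleGraph.isStrictlyPositive_srcDiag hΓ, hM⟩
  · rintro ⟨XY, hXY, hX, hY, hM⟩
    rw [heq]
    exact scalingBound_lt_one hXY hX hY hM
  · rintro ⟨Γ, hΓ, hM⟩
    rw [heq]
    exact AdmissibleGraph.scalingBound_lt_one_of_lmi hΓ hM
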